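/- **Setting.** Let $d\in\{1,2,3\}$ and let $\Omega\subset\mathbb R^d$ be a connected polytopal open set (polytopal: the interior of a finite union of closed nondegenerate simplices). Write $\|\cdot\|_{L^2}$ for the norms of $L^2(\Omega)$ and $L^2(\Omega)^d$. Let $0<\underline\lambda\le\overline\lambda$, $\rho>0$, $C_\nabla\ge0$, and let $k\ge1$, $\ell\ge0$, $1\le s\le \ell+2$ be integers. *Continuous problem.* $\zeta,\beta:\mathbb R\to\mathbb R$ are continuous and non-decreasing, $\zeta(0)=\beta(0)=0$, $\beta+\zeta$ is strictly increasing, and $|\zeta(r)|\ge M_0|r|-M_1$, $|\beta(r)|\le K_0|r|+K_1$ for all $r\in\mathbb R$, for some $M_0,M_1,K_0,K_1>0$; $\Lambda$ is a measurable matrix field on $\Omega$ which is a.e. symmetric with eigenvalues in $[\underline\lambda,\overline\lambda]$; $f\in L^2(\Omega)$. Let $\overline u\in L^2(\Omega)$ be the weak solution with $F=0$: $\zeta(\overline u)\in H^1_0(\Omega)$ and $\int_\Omega\beta(\overline u)\overline v+\int_\Omega\Lambda\nabla\zeta(\overline u)\cdot\nabla\overline v=\int_\Omega f\overline v$ for all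 $\overline v\in H^1_0(\Omega)$. *Discretisation.* $\mathcal M$ is a polytopal mesh of $\Omega$: a finite family of non-empty connected polytopal open subsets (cells) of $\Omega$, pairwise disjoint, with $\overline\Omega=\bigcup_K\overline K$; $h_X$ is the diameter of $X$ and $h=\max_K h_K$. Each $K\in\mathcal M$ is star-shaped with respect to all points of some ball of radius $\rho h_K$. $I$ is a finite set, $I_{\partial\Omega}\subset I$, and $X_{\mathcal D,0}=\{(v_i)_{i\in I}\in\mathbb R^I: v_i=0\ \forall i\in I_{\partial\Omega}\}$. The maps $\Pi_{\mathcal D^*},\Pi_{\mathcal D}:X_{\mathcal D,0}\to L^2(\Omega)$ and $\nabla_{\mathcal D}:X_{\mathcal D,0}\to L^2(\Omega)^d$ are linear, $v\mapsto\|\nabla_{\mathcal D}v\|_{L^2}$ is a norm, and $Q_{\mathcal D}:L^2(\Omega)\to L^2(\Omega)$ is a map. They satisfy: - for all $K\in\mathcal M$ and $v\in X_{\mathcal D,0}$, $(\Pi_{\mathcal D^*}v)_{|K}$ is a polynomial of degree at most $k$, and $\|\nabla_h\Pi_{\mathcal D^*}v\|_{L^2}\le C_\nabla\|\nabla_{\mathcal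 D}v\|_{L^2}$, where $\nabla_h$ is the broken gradient on $\mathcal M$; - there are points $x_i\in\overline\Omega$ ($i\in I$), with $x_i\in\partial\Omega$ if $i\in I_{\partial\Omega}$, and sets $I_K\subset I$ ($K\in\mathcal M$) with $I=I_{\partial\Omega}\cup\bigcup_K I_K$, such that $x_i\in\overline K$ and $v_i=(\Pi_{\mathcal D^*}v)_{|K}(x_i)$ for all $v\in X_{\mathcal D,0}$, $K\in\mathcal M$, $i\in I_K$; - there is a measurable partition $(U_i)_{i\in I}$ of $\Omega$ (some $U_i$ may be empty) with $\Pi_{\mathcal D}v=\sum_i v_i\mathbf 1_{U_i}$ for all $v\in X_{\mathcal D,0}$, $U_i\cap K\ne\emptyset$ only if $i\in I_K$, and $\rho h_{U_i}\le h$; - if $g\in L^\infty(\Omega)$ and $g_{|K}\in C(\overline K)$ for all $K\in\mathcal M$, then $(Q_{\mathcal D}g)_{|K}=\sum_{i\in I_K}g_{|K}(x_i)\mathbf 1_{U_i\cap K}$ for all $K\in\mathcal M$. Let $\mathcal I_{\mathcal D}\zeta(\overline u)\in X_{\mathcal D,0}$ be given by the nodal values of $\zeta(\overline u)$: $(\mathcal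 I_{\mathcal D}\zeta(\overline u))_i=\zeta(\overline u)(x_i)$ for all $i\in I$, where $\zeta(\overline u)(x_i)$ is the essential limit of $\zeta(\overline u)$ at $x_i$, that is, the value at $x_i$ of the representative of $\zeta(\overline u)$ that is continuous on $\overline\Omega$. Set $$C_{\mathcal D^*}=\max_{v\ne0}\frac{\|\Pi_{\mathcal D^*}v\|_{L^2}}{\|\nabla_{\mathcal D}v\|_{L^2}},\qquad W_{\mathcal D^*}(\psi)=\max_{v\ne0}\frac{1}{\|\nabla_{\mathcal D}v\|_{L^2}}\left|\int_\Omega\nabla_{\mathcal D}v\cdot\psi+\Pi_{\mathcal D^*}v\,\mathrm{div}\,\psi\right|\quad(\psi\in H_{\mathrm{div}}(\Omega)),$$ with $v$ ranging over $X_{\mathcal D,0}$ (and both quantities are $0$ if $X_{\mathcal D,0}=\{0\}$). Let $W^{s,\infty}(\mathcal M)$ be the space of $g\in L^\infty(\Omega)$ with $g_{|K}\in W^{s,\infty}(K)$ for all $K\in\mathcal M$, with norm $\|g\|_{W^{s,\infty}(\mathcal M)}=\max_{K}\|g\|_{W^{s,\infty}(K)}$, where $\|g\|_{W^{s,\infty}(K)}$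 is the largest $L^\infty(K)$ norm of the weak partial derivatives of $g_{|K}$ of order at most $s$. **Theorem (High-order error estimate).** There is $C>0$, depending only on $d,\Omega,\underline\lambda,\overline\lambda,\rho,k,C_\nabla,\ell,s$ (in particular not on the mesh, on $(U_i)$, or on the rest of the discretisation), such that the following holds in the setting above. Suppose that the local quadrature rules are exact at degree $k+\ell$: $$\int_K q=\sum_{i\in I_K}|U_i\cap K|\,q(x_i)\qquad\text{for all }K\in\mathcal M\text{ and all polynomials }q\text{ of degree at most }k+\ell,$$ and that $f$ and $\beta(\overline u)$ belong to $W^{s,\infty}(\mathcal M)$. Let $u\in X_{\mathcal D,0}$ be a solution to the gradient scheme $$\int_\Omega\beta(\Pi_{\mathcal D}u)\Pi_{\mathcal D}v+\int_\Omega\Lambda\nabla_{\mathcal D}\zeta(u)\cdot\nabla_{\mathcal D}v=\int_\Omega Q_{\mathcal D}f\,\Pi_{\mathcal D}v\qquad\forall v\in X_{\mathcal D,0},$$ where $\zeta(u)=(\zeta(u_i))_{i\in I}$. Then $$\|\nabla_{\mathcal D}[\mathcal I_{\mathcal D}\zeta(\overline u)-\zeta(u)]\|_{L^2}\le C\Big(W_{\mathcal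 D^*}(\Lambda\nabla\zeta(\overline u))+\|\nabla_{\mathcal D}\mathcal I_{\mathcal D}\zeta(\overline u)-\nabla\zeta(\overline u)\|_{L^2}+h^s(1+C_{\mathcal D^*})\|\beta(\overline u)-f\|_{W^{s,\infty}(\mathcal M)}\Big).$$ -/

import Mathlib

open MeasureTheory Filter Topology Set
open scoped ENNReal ContDiff

noncomputable section

namespace GDM

/-! ### Function spaces -/

/-- The Euclidean space `ℝ^d`. -/
abbrev E (d : ℕ) := EuclideanSpace ℝ (Fin d)

/-- `L²(Ω)`. -/
abbrev L2 {d : ℕ} (Ω : Set (E d)) := Lp ℝ 2 (volume.restrict Ω)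

/-- `L²(Ω)^d`. -/
abbrev L2v {d : ℕ} (Ω : Set (E d)) := Lp (E d) 2 (volume.restrict Ω)

/-- `φ ∈ C_c^∞(S)`. -/
structure IsTest {d : ℕ} (S : Set (E d)) (φ : E d → ℝ) : Prop where
  smooth : ContDiff ℝ ∞ φ
  compact : HasCompactSupport φ
  supp : tsupport φ ⊆ S

/-- `H¹₀(Ω)`, as the set of pairs `(w, ∇w)`: the closure of `C_c^∞(Ω)` for the `H¹(Ω)` topology. -/
def H10 {d : ℕ} (Ω : Set (E d)) : Set (L2 Ω × L2v Ω) :=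
  closure {p | ∃ φ : E d → ℝ, IsTest Ω φ ∧
    p.1 =ᵐ[volume.restrict Ω] φ ∧ p.2 =ᵐ[volume.restrict Ω] gradient φ}

/-- `g` is the weak divergence of `ψ` in `Ω`. -/
def IsWeakDiv {d : ℕ} (Ω : Set (E d)) (ψ : E d → E d) (g : L2 Ω) : Prop :=
  ∀ φ : E d → ℝ, IsTest Ω φ →
    ∫ x in Ω, inner ℝ (ψ x) (gradient φ x) = -∫ x in Ω, g x * φ x

open Classical in
/-- The divergence in `L²(Ω)` of a field `ψ ∈ H_div(Ω)` (and `0` if `ψ` has no weak divergence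
in `L²(Ω)`). -/
def weakDiv {d : ℕ} (Ω : Set (E d)) (ψ : E d → E d) : L2 Ω :=
  if h : ∃ g : L2 Ω, IsWeakDiv Ω ψ g then h.choose else 0

/-- `g'` is the weak partial derivative `∂_{j₁} ⋯ ∂_{jₙ} g` in the open set `K`. -/
def IsWeakPartial {d : ℕ} (K : Set (E d)) {n : ℕ} (j : Fin n → Fin d) (g g' : E d → ℝ) : Prop :=
  ∀ φ : E d → ℝ, IsTest K φ →
    ∫ x in K, g x * iteratedFDeriv ℝ n φ x (fun m => EuclideanSpace.single (j m) 1)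
      = (-1) ^ n * ∫ x in K, g' x * φ x

/-- `g|_K ∈ W^{s,∞}(K)`: all weak partial derivatives of order at most `s` exist and are in
`L^∞(K)`. -/
def MemW {d : ℕ} (K : Set (E d)) (s : ℕ) (g : E d → ℝ) : Prop :=
  ∀ n ≤ s, ∀ j : Fin n → Fin d, ∃ g' : E d → ℝ,
    MemLp g' ∞ (volume.restrict K) ∧ IsWeakPartial K j g g'

open Classical in
/-- The weak partial derivative `∂_{j₁} ⋯ ∂_{jₙ} g ∈ L^∞(K)` (and `0` if there is none). -/
def weakPartial {d : ℕ} (K : Set (E d)) {n : ℕ} (j : Fin n → Fin d) (g : E d → ℝ) : E d → ℝ :=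
  if h : ∃ g' : E d → ℝ, MemLp g' ∞ (volume.restrict K) ∧ IsWeakPartial K j g g'
  then h.choose else 0

/-- `‖g‖_{W^{s,∞}(K)}`, the largest `L^∞(K)` norm of the weak partial derivatives of `g` of order
at most `s`. -/
def wNorm {d : ℕ} (K : Set (E d)) (s : ℕ) (g : E d → ℝ) : ℝ :=
  ⨆ n : Fin (s + 1), ⨆ j : Fin n → Fin d,
    (eLpNorm (weakPartial K j g) ∞ (volume.restrict K)).toReal

/-- `a` is the value at `x` of the class `g` of functions on `Ω` modulo null sets: `g` has the
essential limit `a` at `x`. If `g` has a representative that is continuous on `closure Ω`, this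
means that `a` is the value at `x` of this representative; see `hasNodalValue_iff`. -/
def HasNodalValue {d : ℕ} (Ω : Set (E d)) (g : E d → ℝ) (x : E d) (a : ℝ) : Prop :=
  Tendsto g (𝓝 x ⊓ ae (volume.restrict Ω)) (𝓝 a)

theorem hasNodalValue_iff {d : ℕ} {Ω : Set (E d)} (hΩ : IsOpen Ω) {g z : E d → ℝ}
    (hz : ContinuousOn z (closure Ω)) (hgz : g =ᵐ[volume.restrict Ω] z)
    {x : E d} (hx : x ∈ closure Ω) (a : ℝ) : HasNodalValue Ω g x a ↔ a = z x := by
  have hne : (𝓝 x ⊓ ae (volume.restrict Ω)).NeBot := by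
    rw [Filter.inf_neBot_iff]
    intro s hs t ht
    obtain ⟨o, hos, ho, hxo⟩ := mem_nhds_iff.1 hs
    obtain ⟨y, hyo, hyΩ⟩ := mem_closure_iff.1 hx o ho hxo
    by_contra hemp
    have hsub : o ∩ Ω ⊆ tᶜ ∩ Ω := fun w hw =>
      ⟨fun hwt => hemp ⟨w, hos hw.1, hwt⟩, hw.2⟩
    have h0 : volume (tᶜ ∩ Ω) = 0 := by
      have h1 : (volume.restrict Ω) tᶜ = 0 := ht
      rwa [Measure.restrict_apply' hΩ.measurableSet] at h1
    exact ((ho.inter hΩ).measure_pos volume ⟨y, hyo, hyΩ⟩).ne' (measure_mono_null hsub h0)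
  have hlim : Tendsto g (𝓝 x ⊓ ae (volume.restrict Ω)) (𝓝 (z x)) := by
    have h1 : Tendsto z (𝓝 x ⊓ ae (volume.restrict Ω)) (𝓝 (z x)) := by
      refine (hz x hx).mono_left (le_inf inf_le_left (inf_le_right.trans ?_))
      rw [Filter.le_principal_iff]
      filter_upwards [ae_restrict_mem hΩ.measurableSet] with y hy using subset_closure hy
    exact h1.congr' ((hgz.filter_mono inf_le_right).symm)
  constructor
  · intro h
    exact tendsto_nhds_unique h hlim
  · rintro rfl
    exact hlim

/-! ### The continuous problem -/

/-- The assumptions on the nonlinearities `ζ` and `β`. -/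
structure IsNonlin (ζ β : ℝ → ℝ) : Prop where
  ζ_cont : Continuous ζ
  ζ_mono : Monotone ζ
  ζ_zero : ζ 0 = 0
  ζ_growth : ∃ M₀ M₁ : ℝ, 0 < M₀ ∧ 0 < M₁ ∧ ∀ r, M₀ * |r| - M₁ ≤ |ζ r|
  β_cont : Continuous β
  β_mono : Monotone β
  β_zero : β 0 = 0
  β_growth : ∃ K₀ K₁ : ℝ, 0 < K₀ ∧ 0 < K₁ ∧ ∀ r, |β r| ≤ K₀ * |r| + K₁
  strict : StrictMono (fun r => β r + ζ r)

/-- `Λ` is measurable and, for a.e. `x ∈ Ω`, `Λ(x)` is symmetric with eigenvalues in `[lo, hi]`. -/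
structure IsDiffusion {d : ℕ} (Ω : Set (E d)) (lo hi : ℝ)
    (Λ : E d → Matrix (Fin d) (Fin d) ℝ) : Prop where
  meas : ∀ a b, AEMeasurable (fun x => Λ x a b) (volume.restrict Ω)
  symm : ∀ᵐ x ∂(volume.restrict Ω), (Λ x).IsSymm
  eig : ∀ᵐ x ∂(volume.restrict Ω), ∀ μ : ℝ,
    Module.End.HasEigenvalue (Matrix.toLin' (Λ x)) μ → μ ∈ Icc lo hi

/-- The field `x ↦ Λ(x) G(x)`. -/
def matField {d : ℕ} (Λ : E d → Matrix (Fin d) (Fin d) ℝ) (G : E d → E d) : E d → E d :=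
  fun x => Matrix.toEuclideanLin (Λ x) (G x)

/-- `u ∈ L²(Ω)` is a solution of the weak form of `β(u) - div(Λ ∇ζ(u)) = f + div F` in `Ω`,
`ζ(u) = 0` on `∂Ω`, and `G = ∇ζ(u)`. -/
def IsWeakSol {d : ℕ} (Ω : Set (E d)) (ζ β : ℝ → ℝ) (Λ : E d → Matrix (Fin d) (Fin d) ℝ)
    (f : L2 Ω) (F : L2v Ω) (u : L2 Ω) (G : L2v Ω) : Prop :=
  (∃ z : L2 Ω, z =ᵐ[volume.restrict Ω] (fun x => ζ (u x)) ∧ (z, G) ∈ H10 Ω) ∧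
  ∀ v : L2 Ω, ∀ Gv : L2v Ω, (v, Gv) ∈ H10 Ω →
    (∫ x in Ω, β (u x) * v x) + ∫ x in Ω, inner ℝ (matField Λ G x) (Gv x)
      = (∫ x in Ω, f x * v x) - ∫ x in Ω, inner ℝ (F x) (Gv x)

/-! ### Gradient discretisations -/

/-- A gradient discretisation on `Ω`, with space of unknowns `V` (to be finite-dimensional):
a function reconstruction, a gradient reconstruction such that `v ↦ ‖∇ v‖_{L²}` is a norm, and a
quadrature operator (any map). -/
structure GradDisc {d : ℕ} (Ω : Set (E d)) (V : Type) [AddCommGroup V] [Module ℝ V] where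
  recon : V →ₗ[ℝ] L2 Ω
  grad : V →ₗ[ℝ] L2v Ω
  quad : L2 Ω → L2 Ω
  norm_grad : ∀ v, ‖grad v‖ = 0 → v = 0

/-- The discrete Poincaré constant `C_D`, the maximum of `‖Π v‖ / ‖∇ v‖` over `v ≠ 0`. -/
def GradDisc.poincare {d : ℕ} {Ω : Set (E d)} {V : Type} [AddCommGroup V] [Module ℝ V]
    (D : GradDisc Ω V) : ℝ :=
  sSup {r | ∃ v : V, v ≠ 0 ∧ r = ‖D.recon v‖ / ‖D.grad v‖}

/-- The conformity defect `W_D(ψ)`, for `ψ ∈ H_div(Ω)`. -/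
def GradDisc.defect {d : ℕ} {Ω : Set (E d)} {V : Type} [AddCommGroup V] [Module ℝ V]
    (D : GradDisc Ω V) (ψ : E d → E d) : ℝ :=
  sSup {r | ∃ v : V, v ≠ 0 ∧
    r = |∫ x in Ω, (inner ℝ (D.grad v x) (ψ x) + D.recon v x * weakDiv Ω ψ x)| / ‖D.grad v‖}

/-- The space of families `(v_i)_{i ∈ I}` of reals with `v_i = 0` for all `i ∈ bd`. -/
def X0 {I : Type} (bd : Set I) : Submodule ℝ (I → ℝ) where
  carrier := {v | ∀ i ∈ bd, v i = 0}
  add_mem' := fun ha hb i hi => by simp [ha i hi, hb i hi]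
  zero_mem' := fun _ _ => rfl
  smul_mem' := fun c v hv i hi => by simp [hv i hi]

/-- `g(v) = (g(v_i))_{i ∈ I}`, for `g : ℝ → ℝ` with `g(0) = 0`. -/
def X0.map {I : Type} {bd : Set I} (g : ℝ → ℝ) (hg : g 0 = 0) (v : X0 bd) : X0 bd :=
  ⟨fun i => g (v.1 i), fun i hi => by
    show g (v.1 i) = 0
    rw [v.2 i hi, hg]⟩

/-- The reconstruction of `D` is piecewise constant on the (measurable) partition `(U_i)` of `Ω`. -/
structure IsPiecewiseConst {d : ℕ} {Ω : Set (E d)} {I : Type} [Fintype I] {bd : Set I}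
    (D : GradDisc Ω (X0 bd)) (U : I → Set (E d)) : Prop where
  meas : ∀ i, MeasurableSet (U i)
  disj : ∀ i i', i ≠ i' → Disjoint (U i) (U i')
  union : ⋃ i, U i = Ω
  recon_eq : ∀ v : X0 bd, D.recon v =ᵐ[volume.restrict Ω]
    fun x => ∑ i, v.1 i * (U i).indicator (fun _ => (1 : ℝ)) x

/-- `D` is a mass-lumped version of `Ds`, with partition `(U_i)`. -/
structure IsMassLumped {d : ℕ} {Ω : Set (E d)} {I : Type} [Fintype I] {bd : Set I}
    (Ds D : GradDisc Ω (X0 bd)) (U : I → Set (E d)) : Prop where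
  grad_eq : D.grad = Ds.grad
  quad_eq : D.quad = Ds.quad
  const : IsPiecewiseConst D U

/-- `u` is a solution of the gradient scheme given by `D`. -/
def IsSchemeSol {d : ℕ} {Ω : Set (E d)} {I : Type} {bd : Set I}
    (D : GradDisc Ω (X0 bd)) (ζ β : ℝ → ℝ) (hζ : ζ 0 = 0)
    (Λ : E d → Matrix (Fin d) (Fin d) ℝ) (f : L2 Ω) (F : L2v Ω) (u : X0 bd) : Prop :=
  ∀ v : X0 bd,
    (∫ x in Ω, β (D.recon u x) * D.recon v x)
        + ∫ x in Ω, inner ℝ (matField Λ (D.grad (X0.map ζ hζ u)) x) (D.grad v x)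
      = (∫ x in Ω, D.quad f x * D.recon v x) - ∫ x in Ω, inner ℝ (F x) (D.grad v x)

/-! ### Polytopal meshes -/

/-- A polytopal open set: the interior of a finite union of closed nondegenerate simplices. -/
def IsPolytopal {d : ℕ} (S : Set (E d)) : Prop :=
  ∃ T : Finset (Fin (d + 1) → E d), (∀ t ∈ T, AffineIndependent ℝ t) ∧
    S = interior (⋃ t ∈ T, convexHull ℝ (range t))

/-- The family of cells, indexed by `M`, of a polytopal mesh of `Ω`. -/
structure PolyMesh {d : ℕ} (Ω : Set (E d)) (M : Type) [Fintype M] where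
  cell : M → Set (E d)
  poly : ∀ K, IsPolytopal (cell K)
  conn : ∀ K, IsConnected (cell K)
  sub : ∀ K, cell K ⊆ Ω
  disj : ∀ K K', K ≠ K' → Disjoint (cell K) (cell K')
  cover : closure Ω = ⋃ K, closure (cell K)

/-- The mesh size `h`. -/
def PolyMesh.size {d : ℕ} {Ω : Set (E d)} {M : Type} [Fintype M] (T : PolyMesh Ω M) : ℝ :=
  ⨆ K, Metric.diam (T.cell K)

/-- `g ∈ W^{s,∞}(M)`, the broken Sobolev space. -/
def PolyMesh.MemBroken {d : ℕ} {Ω : Set (E d)} {M : Type} [Fintype M] (T : PolyMesh Ω M)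
    (s : ℕ) (g : E d → ℝ) : Prop :=
  MemLp g ∞ (volume.restrict Ω) ∧ ∀ K, MemW (T.cell K) s g

/-- `‖g‖_{W^{s,∞}(M)}`. -/
def PolyMesh.brokenNorm {d : ℕ} {Ω : Set (E d)} {M : Type} [Fintype M] (T : PolyMesh Ω M)
    (s : ℕ) (g : E d → ℝ) : ℝ :=
  ⨆ K, wNorm (T.cell K) s g

/-- The value at `x` of a polynomial in `d` variables. -/
def peval {d : ℕ} (p : MvPolynomial (Fin d) ℝ) (x : E d) : ℝ :=
  MvPolynomial.eval (fun a => x a) p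

/-- The structure of the discretisation: a polytopal mesh, nodes, a gradient discretisation `Ds`
with local reconstructions in `P^k` and with unknowns that are nodal values, a mass-lumped version
`D` of it, and the nodal quadrature, with regularity parameter `ρ` and broken gradient
constant `Cg`. -/
structure NodalDisc {d : ℕ} (Ω : Set (E d)) (M I : Type) [Fintype M] [Fintype I] (bd : Set I)
    (k : ℕ) (ρ Cg : ℝ) where
  mesh : PolyMesh Ω M
  Ds : GradDisc Ω (X0 bd)
  D : GradDisc Ω (X0 bd)
  /-- `(Π_{D*} v)_{|K}`, a polynomial of degree at most `k` -/
  loc : X0 bd → M → MvPolynomial (Fin d) ℝ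
  loc_deg : ∀ v K, (loc v K).totalDegree ≤ k
  loc_eq : ∀ v K, Ds.recon v =ᵐ[volume.restrict (mesh.cell K)] peval (loc v K)
  /-- the broken gradient of `Π_{D*} v` is bounded by `Cg ‖∇_D v‖` in `L²(Ω)` -/
  grad_bound : ∀ v, Real.sqrt (∑ K, ∫ x in mesh.cell K,
      ∑ a, (peval (MvPolynomial.pderiv a (loc v K)) x) ^ 2) ≤ Cg * ‖Ds.grad v‖
  node : I → E d
  /-- the set `I_K` of the nodes attached to the cell `K` -/
  nodes : M → Finset I
  node_mem : ∀ i, node i ∈ closure Ω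
  node_bd : ∀ i ∈ bd, node i ∈ frontier Ω
  node_cell : ∀ K, ∀ i ∈ nodes K, node i ∈ closure (mesh.cell K)
  nodes_cover : ∀ i, i ∈ bd ∨ ∃ K, i ∈ nodes K
  nodal : ∀ v K, ∀ i ∈ nodes K, v.1 i = peval (loc v K) (node i)
  U : I → Set (E d)
  lumped : IsMassLumped Ds D U
  U_cell : ∀ i K, (U i ∩ mesh.cell K).Nonempty → i ∈ nodes K
  /-- for `g ∈ C(M)`, equal on each cell `K` to `gc K ∈ C(closure K)`, the quadrature `Q_D g` is
  given on `K` by the nodal values of `gc K` -/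
  quad_eq : ∀ (g : L2 Ω) (gc : M → E d → ℝ),
    (∀ K, ContinuousOn (gc K) (closure (mesh.cell K))) →
    (∀ K, g =ᵐ[volume.restrict (mesh.cell K)] gc K) →
    ∀ K, D.quad g =ᵐ[volume.restrict (mesh.cell K)]
      fun x => ∑ i ∈ nodes K, gc K (node i) * (U i ∩ mesh.cell K).indicator (fun _ => (1 : ℝ)) x
  star : ∀ K, ∃ c : E d, ∀ y ∈ Metric.ball c (ρ * Metric.diam (mesh.cell K)),
    StarConvex ℝ y (mesh.cell K)
  diam_U : ∀ i, ρ * Metric.diam (U i) ≤ mesh.size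

/-- The local quadrature rules are exact on polynomials of degree at most `m`. -/
def NodalDisc.Exact {d : ℕ} {Ω : Set (E d)} {M I : Type} [Fintype M] [Fintype I] {bd : Set I}
    {k : ℕ} {ρ Cg : ℝ} (S : NodalDisc Ω M I bd k ρ Cg) (m : ℕ) : Prop :=
  ∀ K, ∀ q : MvPolynomial (Fin d) ℝ, q.totalDegree ≤ m →
    ∫ x in S.mesh.cell K, peval q x
      = ∑ i ∈ S.nodes K, (volume (S.U i ∩ S.mesh.cell K)).toReal * peval q (S.node i)

end GDM

end

open GDM

/-! The proof is an energy estimate for the nodal error e = w - ζ(u), where w is the nodal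
interpolant of ζ(ū). Coercivity of Λ bounds lo‖∇e‖² by ∫Λ∇w·∇e - ∫Λ∇ζ(u)·∇e. In the first integral
∇w is replaced by G = ∇ζ(ū), at the cost of the interpolation error; the scheme rewrites the second.
The flux ΛG has weak divergence g = β(ū) - f, so ∫ΛG·∇e is -∫ g Π*e up to the conformity defect.

What is left compares nodal sums with ∫ g Π*e. Adding and subtracting β(ū) at the nodes gives the
quadrature error for g Π*e, minus a weighted sum of (β(ū)(x_i) - β(u_i))(ζ(ū)(x_i) - ζ(u_i)). Both
factors come from nondecreasing functions of the same quantity, so this sum is nonnegative and can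
be dropped. This holds although ū need not have a value at a node, because the inequality passes to
essential limits (`mul_nodalValue_sub_nonneg`). A node shared by several cells may have a different
value of β(ū) in each.

The order h^s comes from a two-level splitting on each cell (`exists_quadrature_bound`). For a
polynomial p of degree at most k and the centre c of the cell, p(c) g is approximated to order s,
whereas g (p - p(c)) needs order s - 1 only, since the oscillation of p supplies the missing power
of h together with ∇p. Thus exactness at degree k + l suffices up to s = l + 2, and no derivative of
p beyond the first appears.

Two local tools give constants that depend on the shape of a cell only through ρ: polynomial
approximation in W^{m,∞} (`exists_peval_approx`, by mollification and Taylor's formula at c), and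
inverse inequalities obtained from finite dimension by scaling (`exists_inverse_ineq`,
`exists_oscillation_ineq`). Cauchy-Schwarz over the cells, whose volumes add up to |Ω|, makes the
sum independent of the number of cells (`NodalDisc.exists_consistency_bound`). -/

namespace GDM

/-! ### Mollification and weak derivatives -/

open ContinuousLinearMap in
open scoped Convolution in
/-- The iterated derivatives of a convolution with a smooth function fall on that function. -/
theorem iteratedFDeriv_convolution_apply {d : ℕ} {g ψ : E d → ℝ} (hg : LocallyIntegrable g)
    (hψ : ContDiff ℝ ∞ ψ) (hc : HasCompactSupport ψ) (n : ℕ) (v : Fin n → E d) (x : E d) :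
    iteratedFDeriv ℝ n (g ⋆[lsmul ℝ ℝ] ψ) x v
      = (g ⋆[lsmul ℝ ℝ] (fun y => iteratedFDeriv ℝ n ψ y v)) x := by
  induction n generalizing x with
  | zero => simp
  | succ n ih =>
    have hF : ContDiff ℝ ∞ (g ⋆[lsmul ℝ ℝ] ψ) :=
      hc.contDiff_convolution_right (n := ⊤) _ hg hψ
    have hlt : (n : WithTop ℕ∞) < ((⊤ : ℕ∞) : WithTop ℕ∞) := by exact_mod_cast WithTop.coe_lt_top _
    rw [(hF.differentiable_iteratedFDeriv hlt x).iteratedFDeriv_succ_apply_left']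
    have h1 : (fun y => iteratedFDeriv ℝ n (g ⋆[lsmul ℝ ℝ] ψ) y (Fin.tail v))
        = g ⋆[lsmul ℝ ℝ] (fun y => iteratedFDeriv ℝ n ψ y (Fin.tail v)) :=
      funext fun y => ih (Fin.tail v) y
    have hψn : ContDiff ℝ ∞ (iteratedFDeriv ℝ n ψ) := hψ.iteratedFDeriv_right (by norm_cast)
    have h2 : ContDiff ℝ ∞ (fun y => iteratedFDeriv ℝ n ψ y (Fin.tail v)) :=
      (ContinuousMultilinearMap.apply ℝ (fun _ : Fin n => E d) ℝ (Fin.tail v)).contDiff.comp hψn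
    have h3 : HasCompactSupport (fun y => iteratedFDeriv ℝ n ψ y (Fin.tail v)) :=
      (hc.iteratedFDeriv n).comp_left
        (g := fun A : ContinuousMultilinearMap ℝ (fun _ : Fin n => E d) ℝ => A (Fin.tail v)) rfl
    have h21 : ContDiff ℝ 1 (fun y => iteratedFDeriv ℝ n ψ y (Fin.tail v)) :=
      h2.of_le (by exact_mod_cast le_top)
    rw [h1, (h3.hasFDerivAt_convolution_right (lsmul ℝ ℝ) hg h21 x).fderiv,
      convolution_precompR_apply _ hg (h3.fderiv ℝ) (h21.continuous_fderiv one_ne_zero)]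
    congr 1
    ext y
    rw [(hψ.differentiable_iteratedFDeriv hlt y).iteratedFDeriv_succ_apply_left']

/-- The iterated derivatives of an even function. -/
theorem iteratedFDeriv_const_sub_of_even {d : ℕ} {ψ : E d → ℝ} (hψ : ContDiff ℝ ∞ ψ)
    (hev : ∀ y, ψ (-y) = ψ y) (n : ℕ) (x t : E d) (v : Fin n → E d) :
    iteratedFDeriv ℝ n (fun t => ψ (x - t)) t v
      = (-1) ^ n * iteratedFDeriv ℝ n ψ (x - t) v := by
  have h1 : (fun t => ψ (x - t)) = fun t => ψ (t - x) := by
    ext t; rw [← hev, neg_sub]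
  -- As ψ is invariant under z ↦ -z, the chain rule gives Dⁿψ(z) = (-1)ⁿ Dⁿψ(-z).
  have h2 := iteratedFDeriv_comp_const_smul (𝕜 := ℝ) (-1 : ℝ)
    (hψ.of_le (m := n) (by exact_mod_cast le_top))
  have h3 : (fun z => ψ ((-1 : ℝ) • z)) = ψ := by
    ext z; rw [neg_one_smul, hev]
  rw [h3] at h2
  rw [h1, iteratedFDeriv_comp_sub, congrFun h2 (t - x)]
  simp

/-- At a point `x` whose neighbourhood is in `K`, the derivatives of a mollified function are
bounded by the `L^∞(K)` norms of its weak derivatives. -/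
theorem abs_iteratedFDeriv_mollify_le {d : ℕ} {K : Set (E d)}
    {g G g' : E d → ℝ} (hG : LocallyIntegrable G)
    (hgG : g =ᵐ[volume.restrict K] G) {n : ℕ} {j : Fin n → Fin d}
    (hw : IsWeakPartial K j g g') (hg' : MemLp g' ∞ (volume.restrict K))
    (φ : ContDiffBump (0 : E d)) {x : E d} (hx : Metric.closedBall x φ.rOut ⊆ K) :
    |iteratedFDeriv ℝ n (convolution G (φ.normed volume) (ContinuousLinearMap.lsmul ℝ ℝ) volume) x
        (fun m => EuclideanSpace.single (j m) 1)|
      ≤ (eLpNorm g' ∞ (volume.restrict K)).toReal := by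
  set ψ := φ.normed volume with hψdef
  have hψ : ContDiff ℝ ∞ ψ := φ.contDiff_normed
  have hψc : HasCompactSupport ψ := φ.hasCompactSupport_normed
  -- The kernel centred at `x` is supported in the closed ball of radius `φ.rOut`, hence is an
  -- admissible test function on `K`.
  set χ : E d → ℝ := fun t => ψ (x - t) with hχ
  have hsuppn : tsupport χ ⊆ Metric.closedBall x φ.rOut := by
    refine closure_minimal (fun t ht => ?_) Metric.isClosed_closedBall
    have : x - t ∈ Function.support ψ := ht
    rw [hψdef, φ.support_normed_eq] at this
    rw [Metric.mem_closedBall, dist_eq_norm, norm_sub_rev]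
    simpa using (mem_ball_zero_iff.1 this).le
  have hχc : HasCompactSupport χ :=
    (isCompact_closedBall x φ.rOut).of_isClosed_subset (isClosed_tsupport _) hsuppn
  have hχs : ContDiff ℝ ∞ χ := hψ.comp (contDiff_const.sub contDiff_id)
  have htest : IsTest K χ := ⟨hχs, hχc, hsuppn.trans hx⟩
  set e : Fin n → E d := fun m => EuclideanSpace.single (j m) 1
  have hD : ∀ t, iteratedFDeriv ℝ n ψ (x - t) e = (-1) ^ n * iteratedFDeriv ℝ n χ t e := by
    intro t
    rw [hχ, iteratedFDeriv_const_sub_of_even hψ φ.normed_neg, ← mul_assoc, ← mul_pow]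
    simp
  have hzero : ∀ t, t ∉ K → iteratedFDeriv ℝ n χ t e = 0 := by
    intro t ht
    have : t ∉ tsupport (iteratedFDeriv ℝ n χ) :=
      fun h => ht (htest.supp (tsupport_iteratedFDeriv_subset n h))
    rw [image_eq_zero_of_notMem_tsupport this]; rfl
  have hKm : ∀ φ : E d → ℝ, (∀ t, t ∉ K → φ t = 0) → ∫ t, φ t = ∫ t in K, φ t := fun φ h =>
    (setIntegral_eq_integral_of_forall_compl_eq_zero h).symm
  have hχ1 : ∫ t, χ t = 1 := by
    rw [hχ, integral_sub_left_eq_self ψ volume x]; exact φ.integral_normed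
  have hχ0 : ∀ t, 0 ≤ χ t := fun t => φ.nonneg_normed _
  -- The sign (-1)ⁿ of the reflection in `hD` cancels the sign in the definition of the weak
  -- derivative. What remains is an average of `g'` against a probability density.
  have key : iteratedFDeriv ℝ n (convolution G ψ (ContinuousLinearMap.lsmul ℝ ℝ) volume) x e
      = ∫ t in K, g' t * χ t := by
    rw [iteratedFDeriv_convolution_apply hG hψ hψc]
    simp only [convolution, ContinuousLinearMap.lsmul_apply, smul_eq_mul, hD]
    rw [hKm _ (fun t ht => by rw [hzero t ht]; simp)]
    have h1 : ∫ t in K, G t * ((-1) ^ n * iteratedFDeriv ℝ n χ t e)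
        = ∫ t in K, (-1) ^ n * (g t * iteratedFDeriv ℝ n χ t e) := by
      refine integral_congr_ae (hgG.mono fun t ht => ?_)
      simp only [ht]; ring
    rw [h1, integral_const_mul, hw χ htest, ← mul_assoc, ← mul_pow]
    simp
  rw [key]
  set B := (eLpNorm g' ∞ (volume.restrict K)).toReal
  have hB : ∀ᵐ t ∂(volume.restrict K), |g' t| ≤ B := by
    have h := ae_le_eLpNormEssSup (f := g') (μ := volume.restrict K)
    filter_upwards [h] with t ht
    rw [← Real.norm_eq_abs, ← toReal_enorm]
    refine ENNReal.toReal_mono hg'.2.ne ?_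
    rwa [eLpNorm_exponent_top]
  have hχi : Integrable χ := hχs.continuous.integrable_of_hasCompactSupport hχc
  calc |∫ t in K, g' t * χ t| ≤ ∫ t in K, B * χ t := by
        rw [← Real.norm_eq_abs]
        refine norm_integral_le_of_norm_le (hχi.restrict.const_mul B) (hB.mono fun t ht => ?_)
        rw [norm_mul, Real.norm_eq_abs, Real.norm_of_nonneg (hχ0 t)]
        exact mul_le_mul_of_nonneg_right ht (hχ0 t)
    _ = B * ∫ t, χ t := by
        rw [integral_const_mul, ← hKm χ]
        intro t ht
        exact image_eq_zero_of_notMem_tsupport fun h => ht (htest.supp h)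
    _ = B := by rw [hχ1, mul_one]

/-! ### Taylor polynomials -/

/-- A multilinear map on `ℝ^d`, on the diagonal, is bounded by its values on basis vectors. -/
theorem abs_multilinear_diag_le {d n : ℕ} (A : ContinuousMultilinearMap ℝ (fun _ : Fin n => E d) ℝ)
    {N : ℝ} (hA : ∀ j : Fin n → Fin d, |A (fun m => EuclideanSpace.single (j m) 1)| ≤ N) (v : E d) :
    |A (fun _ => v)| ≤ d ^ n * ‖v‖ ^ n * N := by
  have hv : v = ∑ a, v a • (EuclideanSpace.single a 1 : E d) := by
    ext b
    simp [Finset.sum_apply, Pi.single_apply]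
  have hexp : A (fun _ => v) = ∑ j : Fin n → Fin d, (∏ m, v (j m)) *
      A (fun m => EuclideanSpace.single (j m) 1) := by
    conv_lhs => rw [hv]
    rw [A.map_sum (fun (_ : Fin n) (a : Fin d) => v a • (EuclideanSpace.single a 1 : E d))]
    refine Finset.sum_congr rfl fun j _ => ?_
    rw [A.map_smul_univ (fun m => v (j m)) (fun m => EuclideanSpace.single (j m) 1), smul_eq_mul]
  rw [hexp]
  refine (Finset.abs_sum_le_sum_abs _ _).trans ?_
  have hb : ∀ j ∈ (Finset.univ : Finset (Fin n → Fin d)), |(∏ m, v (j m)) *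
      A (fun m => EuclideanSpace.single (j m) 1)| ≤ ‖v‖ ^ n * N := by
    intro j _
    rw [abs_mul, Finset.abs_prod]
    refine mul_le_mul ?_ (hA j) (abs_nonneg _) (by positivity)
    refine (Finset.prod_le_prod (fun _ _ => abs_nonneg _)
      (fun m _ => (EuclideanSpace.norm_eq v ▸ PiLp.norm_apply_le v (j m) : |v (j m)| ≤ ‖v‖))).trans ?_
    simp
  refine (Finset.sum_le_card_nsmul _ _ _ hb).trans (le_of_eq ?_)
  simp [mul_assoc]

/-- The diagonal of a multilinear map on `ℝ^d` is a polynomial. -/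
theorem exists_peval_eq_multilinear {d n : ℕ}
    (A : ContinuousMultilinearMap ℝ (fun _ : Fin n => E d) ℝ) (c : E d) (τ : ℝ) :
    ∃ q : MvPolynomial (Fin d) ℝ, q.totalDegree ≤ n ∧
      ∀ x, peval q x = A (fun _ => τ • (x - c)) := by
  refine ⟨∑ j : Fin n → Fin d, MvPolynomial.C (A (fun m => EuclideanSpace.single (j m) 1)) *
    ∏ m, (MvPolynomial.C τ * (MvPolynomial.X (j m) - MvPolynomial.C (c (j m)))), ?_, ?_⟩
  · refine MvPolynomial.totalDegree_finsetSum_le fun j _ => ?_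
    refine (MvPolynomial.totalDegree_mul _ _).trans ?_
    rw [MvPolynomial.totalDegree_C, zero_add]
    refine (MvPolynomial.totalDegree_finsetProd _ _).trans ?_
    refine (Finset.sum_le_card_nsmul _ _ 1 fun m _ => ?_).trans (by simp)
    refine (MvPolynomial.totalDegree_mul _ _).trans ?_
    rw [MvPolynomial.totalDegree_C, zero_add]
    refine (MvPolynomial.totalDegree_sub_C_le _ _).trans ?_
    simp
  · intro x
    set v := τ • (x - c) with hvdef
    have hv : v = ∑ a, v a • (EuclideanSpace.single a 1 : E d) := by
      ext b
      simp [Finset.sum_apply, Pi.single_apply]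
    conv_rhs => rw [hv]
    rw [A.map_sum (fun (_ : Fin n) (a : Fin d) => v a • (EuclideanSpace.single a 1 : E d))]
    simp only [peval, map_sum, map_mul, MvPolynomial.eval_C, map_prod, map_sub, MvPolynomial.eval_X]
    refine Finset.sum_congr rfl fun j _ => ?_
    rw [A.map_smul_univ (fun m => v (j m)) (fun m => EuclideanSpace.single (j m) 1), smul_eq_mul,
      mul_comm]
    simp [hvdef]

/-- Taylor's formula for a function with bounded partial derivatives of order `m` on a segment. -/
theorem exists_peval_taylor {d : ℕ} {F : E d → ℝ} (hF : ContDiff ℝ ∞ F) (m : ℕ) (c : E d) (τ : ℝ)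
    (N : ℝ) :
    ∃ q : MvPolynomial (Fin d) ℝ, q.totalDegree ≤ m - 1 ∧ ∀ x : E d,
      (∀ t ∈ Icc (0 : ℝ) 1, ∀ j : Fin m → Fin d,
        |iteratedFDeriv ℝ m F (c + t • (τ • (x - c))) (fun i => EuclideanSpace.single (j i) 1)| ≤ N) →
      |F (c + τ • (x - c)) - peval q x| ≤ d ^ m * ‖τ • (x - c)‖ ^ m * N := by
  -- At order 0 the approximation is by the zero polynomial, and the hypothesis at t = 1 is the
  -- claim.
  rcases m with _ | n
  · refine ⟨0, by simp, fun x hx => ?_⟩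
    have := hx 1 (by simp) Fin.elim0
    simpa [peval] using this
  · choose q hqd hqe using fun k => exists_peval_eq_multilinear (iteratedFDeriv ℝ k F c) c τ
    refine ⟨∑ k ∈ Finset.range (n + 1), MvPolynomial.C ((k.factorial : ℝ)⁻¹) * q k, ?_, ?_⟩
    · refine MvPolynomial.totalDegree_finsetSum_le fun k hk => ?_
      refine (MvPolynomial.totalDegree_mul _ _).trans ?_
      rw [MvPolynomial.totalDegree_C, zero_add]
      have := Finset.mem_range.1 hk
      exact (hqd k).trans (by omega)
    · intro x hx
      have hT := map_add_eq_sum_add_integral_iteratedFDeriv (f := F) (x := c) (y := τ • (x - c))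
        (n := n) (fun t _ => (hF.of_le (by exact_mod_cast le_top)).contDiffAt)
      have hq : peval (∑ k ∈ Finset.range (n + 1), MvPolynomial.C ((k.factorial : ℝ)⁻¹) * q k) x
          = ∑ k ∈ Finset.range (n + 1),
            (k.factorial : ℝ)⁻¹ • iteratedFDeriv ℝ k F c (fun _ => τ • (x - c)) := by
        simp only [← hqe]
        simp [peval]
      rw [hq, hT, add_sub_cancel_left]
      -- Integral form of the remainder; the factors (1 - t)ⁿ and 1/n! are at most 1 and are
      -- discarded.
      have hb : ∀ t ∈ Set.uIoc (0 : ℝ) 1,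
          ‖(1 - t) ^ n • iteratedFDeriv ℝ (n + 1) F (c + t • (τ • (x - c))) (fun _ => τ • (x - c))‖
            ≤ d ^ (n + 1) * ‖τ • (x - c)‖ ^ (n + 1) * N := by
        intro t ht
        rw [uIoc_of_le zero_le_one] at ht
        have h1 := abs_multilinear_diag_le _ (hx t ⟨ht.1.le, ht.2⟩) (τ • (x - c))
        rw [norm_smul, Real.norm_eq_abs, Real.norm_eq_abs]
        refine (mul_le_of_le_one_left (abs_nonneg _) ?_).trans h1
        rw [abs_of_nonneg (pow_nonneg (by linarith [ht.2]) n)]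
        exact pow_le_one₀ (by linarith [ht.2]) (by linarith [ht.1])
      have h2 := intervalIntegral.norm_integral_le_of_norm_le_const hb
      rw [sub_zero, abs_one, mul_one] at h2
      rw [smul_eq_mul, abs_mul]
      refine (mul_le_of_le_one_left (abs_nonneg _) ?_).trans h2
      rw [abs_of_nonneg (by positivity)]
      exact inv_le_one_of_one_le₀ (by exact_mod_cast n.factorial_pos)

/-! ### Quantitative bounds on weak derivatives -/

/-- All weak partial derivatives of `g` in `K` of order at most `s` are bounded by `N`. -/
def WeakBound {d : ℕ} (K : Set (E d)) (s : ℕ) (N : ℝ) (g : E d → ℝ) : Prop :=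
  ∀ n ≤ s, ∀ j : Fin n → Fin d, ∃ g' : E d → ℝ, MemLp g' ∞ (volume.restrict K) ∧
    IsWeakPartial K j g g' ∧ (eLpNorm g' ∞ (volume.restrict K)).toReal ≤ N

/-- Trades the norm, whose derivatives are picked by choice, for an existential bound that is
monotone in the order and in the constant. The suprema run over finite index sets, so each term lies
below them. -/
theorem MemW.weakBound {d : ℕ} {K : Set (E d)} {s : ℕ} {g : E d → ℝ} (h : MemW K s g) :
    WeakBound K s (wNorm K s g) g := by
  intro n hn j
  have hex := h n hn j
  have hs : MemLp (weakPartial K j g) ∞ (volume.restrict K) ∧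
      IsWeakPartial K j g (weakPartial K j g) := by
    rw [weakPartial, dif_pos hex]
    exact hex.choose_spec
  refine ⟨weakPartial K j g, hs.1, hs.2, ?_⟩
  have h1 : (eLpNorm (weakPartial K j g) ∞ (volume.restrict K)).toReal
      ≤ ⨆ j : Fin n → Fin d, (eLpNorm (weakPartial K j g) ∞ (volume.restrict K)).toReal :=
    le_ciSup (f := fun j : Fin n → Fin d =>
      (eLpNorm (weakPartial K j g) ∞ (volume.restrict K)).toReal) (Set.finite_range _).bddAbove j
  exact h1.trans (le_ciSup (f := fun n : Fin (s + 1) => ⨆ j : Fin n → Fin d,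
    (eLpNorm (weakPartial K j g) ∞ (volume.restrict K)).toReal)
    (Set.finite_range _).bddAbove ⟨n, Nat.lt_succ_of_le hn⟩)

theorem wNorm_nonneg {d : ℕ} (K : Set (E d)) (s : ℕ) (g : E d → ℝ) : 0 ≤ wNorm K s g :=
  Real.iSup_nonneg fun _ => Real.iSup_nonneg fun _ => ENNReal.toReal_nonneg

theorem WeakBound.mono {d : ℕ} {K : Set (E d)} {s s' : ℕ} {N N' : ℝ} {g : E d → ℝ}
    (h : WeakBound K s N g) (hs : s' ≤ s) (hN : N ≤ N') : WeakBound K s' N' g := fun n hn j =>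
  let ⟨g', h1, h2, h3⟩ := h n (hn.trans hs) j
  ⟨g', h1, h2, h3.trans hN⟩

theorem convolution_lsmul_comm {d : ℕ} (f g : E d → ℝ) :
    convolution f g (ContinuousLinearMap.lsmul ℝ ℝ) volume
      = convolution g f (ContinuousLinearMap.lsmul ℝ ℝ) volume := by
  have h : (ContinuousLinearMap.lsmul ℝ ℝ : ℝ →L[ℝ] ℝ →L[ℝ] ℝ).flip
      = ContinuousLinearMap.lsmul ℝ ℝ := by ext; simp
  rw [← convolution_flip, h]

theorem contDiff_mollify {d : ℕ} {G : E d → ℝ} (hG : LocallyIntegrable G)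
    (φ : ContDiffBump (0 : E d)) :
    ContDiff ℝ ∞ (convolution G (φ.normed volume) (ContinuousLinearMap.lsmul ℝ ℝ) volume) :=
  φ.hasCompactSupport_normed.contDiff_convolution_right (n := ⊤) _ hG φ.contDiff_normed

/-! ### Domains star-shaped with respect to a ball -/

/-- `K` is open, nonempty, star-shaped with respect to the ball `B(c, r)`, and contained in the closed
ball of radius `R` with the same centre. -/
structure IsStarBall {d : ℕ} (K : Set (E d)) (c : E d) (r R : ℝ) : Prop where
  isOpen : IsOpen K
  nonempty : K.Nonempty
  pos : 0 < r
  star : ∀ y ∈ Metric.ball c r, StarConvex ℝ y K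
  sub : K ⊆ Metric.closedBall c R

namespace IsStarBall

variable {d : ℕ} {K : Set (E d)} {c : E d} {r R : ℝ}

theorem star_center (h : IsStarBall K c r R) : StarConvex ℝ c K :=
  h.star c (Metric.mem_ball_self h.pos)

/-- The ball is the image of B(c, r) under the homothety of centre `x` and ratio τ, so each of its
points lies on a segment from `x` to a point of B(c, r). -/
theorem ball_sub (h : IsStarBall K c r R) {x : E d} (hx : x ∈ K) {τ : ℝ} (h0 : 0 < τ) (h1 : τ ≤ 1) :
    Metric.ball (x + τ • (c - x)) (τ * r) ⊆ K := by
  intro z hz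
  set w := z - (x + τ • (c - x)) with hw
  have hwn : ‖w‖ < τ * r := by rwa [Metric.mem_ball, dist_eq_norm] at hz
  have hy : c + τ⁻¹ • w ∈ Metric.ball c r := by
    rw [Metric.mem_ball, dist_eq_norm, add_sub_cancel_left, norm_smul, norm_inv,
      Real.norm_of_nonneg h0.le, inv_mul_lt_iff₀ h0]
    exact hwn
  have hmem := h.star _ hy hx h0.le (sub_nonneg.2 h1) (by ring)
  have hz' : τ • (c + τ⁻¹ • w) + (1 - τ) • x = z := by
    rw [smul_add, smul_smul, mul_inv_cancel₀ h0.ne', one_smul, hw]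
    module
  rwa [hz'] at hmem

theorem dist_le (h : IsStarBall K c r R) {x : E d} (hx : x ∈ K) : ‖c - x‖ ≤ R := by
  have := h.sub hx
  rwa [Metric.mem_closedBall, dist_comm, dist_eq_norm] at this

theorem radius_nonneg (h : IsStarBall K c r R) : 0 ≤ R :=
  let ⟨_, hx⟩ := h.nonempty
  (norm_nonneg _).trans (h.dist_le hx)

theorem ball_center_sub (h : IsStarBall K c r R) : Metric.ball c r ⊆ K :=
  fun y hy => (h.star y hy).mem h.nonempty

theorem isBounded (h : IsStarBall K c r R) : Bornology.IsBounded K :=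
  Metric.isBounded_closedBall.subset h.sub

/-- Two points `x`, `y` of `K` are joined by a polygonal path in `K` of length at most a constant
times `‖x - y‖`. -/
theorem exists_path (h : IsStarBall K c r R) {x y : E d} (hx : x ∈ K) (hy : y ∈ K) :
    ∃ x' y' : E d, segment ℝ x x' ⊆ K ∧ segment ℝ x' y' ⊆ K ∧ segment ℝ y' y ⊆ K ∧
      ‖x - x'‖ + ‖x' - y'‖ + ‖y' - y‖ ≤ (2 * R / r + 1) * ‖x - y‖ := by
  have hR := h.dist_le hx
  have hR0 : 0 ≤ R := (norm_nonneg _).trans hR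
  have hr := h.pos
  have hc : ∀ z ∈ K, segment ℝ z c ⊆ K := fun z hz => by
    rw [segment_symm]; exact starConvex_iff_segment_subset.1 h.star_center hz
  -- Distant points are joined through `c`: the length is at most 2R, which is at most (2R/r)‖x -
  -- y‖.
  rcases le_or_gt r ‖x - y‖ with hxy | hxy
  · have hcK : c ∈ K := hc x hx (right_mem_segment ℝ x c)
    refine ⟨c, c, hc x hx, by simpa using hcK, by rw [segment_symm]; exact hc y hy, ?_⟩
    have h1 : 2 * R ≤ 2 * R / r * ‖x - y‖ := by
      rw [div_mul_eq_mul_div, le_div_iff₀ hr]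
      exact mul_le_mul_of_nonneg_left hxy (by positivity)
    have h2 := h.dist_le hy
    rw [norm_sub_rev] at hR
    rw [sub_self, norm_zero]
    nlinarith [norm_nonneg (x - y)]
  · rcases eq_or_ne x y with rfl | hne
    · exact ⟨x, x, by simpa using hx, by simpa using hx, by simpa using hx, by simp⟩
    -- Close points are both moved towards `c` by the fraction τ for which the ball of `ball_sub`
    -- has radius τr = ‖x - y‖. It contains both moved points, which are at distance (1 - τ)‖x - y‖.
    set τ := ‖x - y‖ / r with hτ
    have h0 : 0 < τ := div_pos (norm_pos_iff.2 (sub_ne_zero.2 hne)) hr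
    have h1 : τ ≤ 1 := (div_le_one hr).2 hxy.le
    have hτr : τ * r = ‖x - y‖ := div_mul_cancel₀ _ hr.ne'
    have hseg : ∀ z ∈ K, segment ℝ z (z + τ • (c - z)) ⊆ K := fun z hz => by
      refine ((convex_segment z c).segment_subset (left_mem_segment ℝ z c) ?_).trans (hc z hz)
      rw [segment_eq_image']
      exact ⟨τ, ⟨h0.le, h1⟩, rfl⟩
    have hd : (x + τ • (c - x)) - (y + τ • (c - y)) = (1 - τ) • (x - y) := by module
    have hdn : ‖(x + τ • (c - x)) - (y + τ • (c - y))‖ = (1 - τ) * ‖x - y‖ := by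
      rw [hd, norm_smul, Real.norm_of_nonneg (sub_nonneg.2 h1)]
    have hpos : 0 < ‖x - y‖ := norm_pos_iff.2 (sub_ne_zero.2 hne)
    refine ⟨x + τ • (c - x), y + τ • (c - y), hseg x hx, ?_, ?_, ?_⟩
    · have hb := h.ball_sub hx h0 h1
      refine ((convex_ball _ _).segment_subset (Metric.mem_ball_self (by positivity)) ?_).trans hb
      rw [Metric.mem_ball, dist_comm, dist_eq_norm, hdn, hτr]
      nlinarith
    · rw [segment_symm]; exact hseg y hy
    · have e1 : ‖x - (x + τ • (c - x))‖ ≤ τ * R := by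
        rw [sub_add_cancel_left, norm_neg, norm_smul, Real.norm_of_nonneg h0.le]
        exact mul_le_mul_of_nonneg_left (h.dist_le hx) h0.le
      have e2 : ‖y + τ • (c - y) - y‖ ≤ τ * R := by
        rw [add_sub_cancel_left, norm_smul, Real.norm_of_nonneg h0.le]
        exact mul_le_mul_of_nonneg_left (h.dist_le hy) h0.le
      rw [hdn]
      have e3 : (2 * R / r + 1) * ‖x - y‖ = 2 * (τ * R) + ‖x - y‖ := by
        rw [hτ]; field_simp
      rw [e3]
      nlinarith

end IsStarBall

/-! ### Lipschitz representatives and polynomial approximation -/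

/-- The derivative of a smooth function is bounded by its partial derivatives. -/
theorem norm_fderiv_le_of_partial {d : ℕ} {F : E d → ℝ} {x : E d} {N : ℝ}
    (h : ∀ j : Fin 1 → Fin d,
      |iteratedFDeriv ℝ 1 F x (fun m => EuclideanSpace.single (j m) 1)| ≤ N) :
    ‖fderiv ℝ F x‖ ≤ d * |N| := by
  refine ContinuousLinearMap.opNorm_le_bound _ (by positivity) fun v => ?_
  have h1 := abs_multilinear_diag_le _ (fun j => (h j).trans (le_abs_self N)) v
  rw [iteratedFDeriv_one_apply, pow_one, pow_one] at h1
  rw [Real.norm_eq_abs]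
  linarith

/-- A function in `W^{1,∞}(K)` is Lipschitz continuous, if `K` is star-shaped with respect to a
ball. -/
theorem exists_lipschitz_rep {d : ℕ} {K : Set (E d)} {c : E d} {r R : ℝ}
    (hK : IsStarBall K c r R) {g : E d → ℝ} (hg : IntegrableOn g K) {N : ℝ}
    (hN : WeakBound K 1 N g) :
    ∃ (L : NNReal) (gc : E d → ℝ), LipschitzWith L gc ∧ g =ᵐ[volume.restrict K] gc := by
  have hR0 := hK.radius_nonneg
  have hr := hK.pos
  set G := K.indicator g with hGdef
  have hG : LocallyIntegrable G :=
    ((integrable_indicator_iff hK.isOpen.measurableSet).2 hg).locallyIntegrable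
  have hgG : g =ᵐ[volume.restrict K] G := (indicator_ae_eq_restrict hK.isOpen.measurableSet).symm
  -- The ratio 2 of outer to inner radius is fixed, as required for almost everywhere convergence of
  -- the mollified functions.
  let φ : ℕ → ContDiffBump (0 : E d) := fun n =>
    ⟨1 / ((n : ℝ) + 1) / 2, 1 / ((n : ℝ) + 1), by positivity, half_lt_self (by positivity)⟩
  have hφ : Tendsto (fun n => (φ n).rOut) atTop (𝓝 0) := tendsto_one_div_add_atTop_nhds_zero_nat
  set F : ℕ → E d → ℝ := fun n =>
    convolution G ((φ n).normed volume) (ContinuousLinearMap.lsmul ℝ ℝ) volume with hF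
  have hlim : ∀ᵐ x ∂(volume : Measure (E d)), Tendsto (fun n => F n x) atTop (𝓝 (G x)) := by
    have := ContDiffBump.ae_convolution_tendsto_right_of_locallyIntegrable (μ := volume) (K := 2)
      hφ (Eventually.of_forall fun n => by simp only [φ]; linarith) hG
    simpa only [hF, convolution_lsmul_comm G] using this
  -- A segment in `K` is compact, so it has a closed thickening inside `K`. For small radii the
  -- gradient of the mollified function is therefore bounded along it.
  have hsegm : ∀ a b : E d, segment ℝ a b ⊆ K →
      ∀ᶠ n in atTop, |F n a - F n b| ≤ d * |N| * ‖a - b‖ := by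
    intro a b hab
    have hcomp : IsCompact (segment ℝ a b) := by
      rw [segment_eq_image']
      exact isCompact_Icc.image (by fun_prop)
    obtain ⟨δ, hδ, hsub⟩ := hcomp.exists_cthickening_subset_open hK.isOpen hab
    filter_upwards [hφ.eventually (eventually_le_nhds hδ)] with n hn
    have := (convex_segment a b).norm_image_sub_le_of_norm_fderiv_le (f := F n) (C := d * |N|)
      (fun x _ => ((contDiff_mollify hG (φ n)).differentiable (by simp)) x)
      (fun x hx => norm_fderiv_le_of_partial fun j => by
        obtain ⟨g', h1, h2, h3⟩ := hN 1 le_rfl j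
        refine (abs_iteratedFDeriv_mollify_le hG hgG h2 h1 (φ n) ?_).trans h3
        exact (Metric.closedBall_subset_closedBall hn).trans
          ((Metric.closedBall_subset_cthickening hx δ).trans hsub))
      (right_mem_segment ℝ a b) (left_mem_segment ℝ a b)
    simpa using this
  set A : Set (E d) := {x | x ∈ K ∧ Tendsto (fun n => F n x) atTop (𝓝 (G x))}
  -- The bound along segments is summed over the polygonal path and passed to the limit on the set
  -- `A`, which has full measure in `K`.
  have hLip : LipschitzOnWith (Real.toNNReal (d * |N| * (2 * R / r + 1))) G A := by
    refine LipschitzOnWith.of_dist_le_mul fun x hx y hy => ?_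
    rw [Real.coe_toNNReal _ (by positivity), Real.dist_eq, dist_eq_norm]
    obtain ⟨x', y', s1, s2, s3, hlen⟩ := hK.exists_path hx.1 hy.1
    refine le_of_tendsto (hx.2.sub hy.2).abs ?_
    filter_upwards [hsegm _ _ s1, hsegm _ _ s2, hsegm _ _ s3] with n h1 h2 h3
    have h4 : F n x - F n y = (F n x - F n x') + (F n x' - F n y') + (F n y' - F n y) := by ring
    rw [h4]
    refine (abs_add_three _ _ _).trans ((add_le_add (add_le_add h1 h2) h3).trans ?_)
    rw [← mul_add, ← mul_add, mul_assoc _ (2 * R / r + 1)]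
    exact mul_le_mul_of_nonneg_left hlen (by positivity)
  obtain ⟨gc, hgc, hEq⟩ := hLip.extend_real
  refine ⟨_, gc, hgc, ?_⟩
  filter_upwards [ae_restrict_mem hK.isOpen.measurableSet, ae_restrict_of_ae hlim, hgG]
    with x hx hl h1
  rw [h1, hEq ⟨hx, hl⟩]

theorem continuous_peval {d : ℕ} (q : MvPolynomial (Fin d) ℝ) : Continuous (peval q) :=
  (MvPolynomial.continuous_eval q).comp (by fun_prop)

/-- Polynomial approximation of order `m` in a domain which is star-shaped with respect to a
ball. -/
theorem exists_peval_approx {d : ℕ} {K : Set (E d)} {c : E d} {r R : ℝ}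
    (hK : IsStarBall K c r R) {g gc : E d → ℝ} {L : NNReal} (hL : LipschitzWith L gc)
    (hgc : g =ᵐ[volume.restrict K] gc) {m : ℕ} {N : ℝ} (hN : WeakBound K m N g) (hN0 : 0 ≤ N)
    {δ : ℝ} (hδ : 0 < δ) :
    ∃ q : MvPolynomial (Fin d) ℝ, q.totalDegree ≤ m - 1 ∧
      ∀ x ∈ closure K, |gc x - peval q x| ≤ d ^ m * R ^ m * N + δ := by
  have hr := hK.pos
  have hR := hK.radius_nonneg
  -- Contracting towards `c` by 1 - θ leaves room for a ball of radius θr inside `K`, hence for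
  -- mollification at scale ε < θr. The contraction and the mollification each cost at most δ/2. The
  -- Lipschitz constant `L` enters only the choice of θ and ε, so it is absent from the final bound.
  set θ : ℝ := min (1 / 2) (δ / (2 * (L * R + 1))) with hθ
  have hLR : (0 : ℝ) ≤ L * R := mul_nonneg L.2 hR
  have hθ0 : 0 < θ := lt_min (by norm_num) (by positivity)
  have hθ1 : θ ≤ 1 := (min_le_left _ _).trans (by norm_num)
  have hθδ : L * R * θ ≤ δ / 2 := by
    have h1 : θ ≤ δ / (2 * (L * R + 1)) := min_le_right _ _
    rw [le_div_iff₀ (by positivity)] at h1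
    nlinarith
  set ε : ℝ := min (θ * r / 2) (δ / (2 * (L + 1))) with hε
  have hL0 : (0 : ℝ) ≤ L := L.2
  have hε0 : 0 < ε := lt_min (by positivity) (by positivity)
  have hεr : ε < θ * r := (min_le_left _ _).trans_lt (half_lt_self (by positivity))
  have hεδ : L * ε ≤ δ / 2 := by
    have h1 : ε ≤ δ / (2 * (L + 1)) := min_le_right _ _
    rw [le_div_iff₀ (by positivity)] at h1
    nlinarith
  let φ : ContDiffBump (0 : E d) := ⟨ε / 2, ε, by positivity, half_lt_self hε0⟩
  have hGi : LocallyIntegrable gc := hL.continuous.locallyIntegrable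
  set F := convolution gc (φ.normed volume) (ContinuousLinearMap.lsmul ℝ ℝ) volume with hF
  have hFgc : ∀ y, |F y - gc y| ≤ δ / 2 := by
    intro y
    rw [hF, convolution_lsmul_comm, ← Real.dist_eq]
    refine ContDiffBump.dist_normed_convolution_le hL.continuous.aestronglyMeasurable
      fun z hz => (hL.dist_le_mul z y).trans ((mul_le_mul_of_nonneg_left ?_ hL0).trans hεδ)
    exact (Metric.mem_ball.1 hz).le
  obtain ⟨q, hqd, hq⟩ := exists_peval_taylor (contDiff_mollify hGi φ) m c (1 - θ) N
  refine ⟨q, hqd, ?_⟩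
  have hcl : IsClosed {x | |gc x - peval q x| ≤ d ^ m * R ^ m * N + δ} :=
    isClosed_le ((hL.continuous.sub (continuous_peval q)).abs) continuous_const
  refine fun x hx => closure_minimal (fun x hx => ?_) hcl hx
  have hT := hq x (fun t ht j => by
    obtain ⟨g', h1, h2, h3⟩ := hN m le_rfl j
    refine (abs_iteratedFDeriv_mollify_le hGi hgc h2 h1 φ ?_).trans h3
    have hx' : c + t • (x - c) ∈ K := by
      refine starConvex_iff_segment_subset.1 hK.star_center hx ?_
      rw [segment_eq_image']
      exact ⟨t, ht, rfl⟩
    -- Each point of the Taylor segment is a point of `K` moved towards `c` by the fraction θ, so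
    -- `ball_sub` applies.
    have he : c + t • ((1 - θ) • (x - c))
        = (c + t • (x - c)) + θ • (c - (c + t • (x - c))) := by module
    rw [he]
    exact (Metric.closedBall_subset_ball hεr).trans (hK.ball_sub hx' hθ0 hθ1))
  have hdist : |gc x - gc (c + (1 - θ) • (x - c))| ≤ δ / 2 := by
    rw [← Real.dist_eq]
    refine (hL.dist_le_mul _ _).trans (le_trans ?_ hθδ)
    rw [dist_eq_norm, mul_assoc]
    refine mul_le_mul_of_nonneg_left ?_ hL0
    have : x - (c + (1 - θ) • (x - c)) = -(θ • (c - x)) := by module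
    rw [this, norm_neg, norm_smul, Real.norm_of_nonneg hθ0.le, mul_comm]
    exact mul_le_mul_of_nonneg_right (hK.dist_le hx) hθ0.le
  have hnorm : ‖(1 - θ) • (x - c)‖ ≤ R := by
    rw [norm_smul, Real.norm_of_nonneg (by linarith), norm_sub_rev]
    nlinarith [hK.dist_le hx, norm_nonneg (c - x)]
  have hpow : (d : ℝ) ^ m * ‖(1 - θ) • (x - c)‖ ^ m * N ≤ d ^ m * R ^ m * N := by
    gcongr
  have hF1 := hFgc (c + (1 - θ) • (x - c))
  change |gc x - peval q x| ≤ _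
  rw [abs_le] at *
  constructor <;> linarith [hT.1, hT.2, hdist.1, hdist.2, hF1.1, hF1.2]

/-! ### Inverse inequalities for polynomials -/

theorem norm_sq_eq_integral {α F : Type*} [MeasurableSpace α] {μ : Measure α}
    [NormedAddCommGroup F] [InnerProductSpace ℝ F] (f : Lp F 2 μ) :
    ‖f‖ ^ 2 = ∫ x, ‖f x‖ ^ 2 ∂μ := by
  rw [← real_inner_self_eq_norm_sq, L2.inner_def]
  exact integral_congr_ae (Eventually.of_forall fun x => real_inner_self_eq_norm_sq _)

theorem memLp_of_continuous_of_isBounded {d : ℕ} {f : E d → ℝ} (hf : Continuous f) {S : Set (E d)}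
    (hS : Bornology.IsBounded S) (hSm : MeasurableSet S) (p : ℝ≥0∞) :
    MemLp f p (volume.restrict S) := by
  have : IsFiniteMeasure (volume.restrict S) :=
    ⟨by rw [Measure.restrict_apply_univ]; exact hS.measure_lt_top⟩
  obtain ⟨B, hB⟩ := (hS.isCompact_closure.image hf).isBounded.exists_norm_le
  refine MemLp.of_bound hf.aestronglyMeasurable B ?_
  filter_upwards [ae_restrict_mem hSm] with x hx
  exact hB _ ⟨x, subset_closure hx, rfl⟩

/-- The ball contains a cube, a product of infinite sets, and a polynomial vanishing on such a
product is zero. -/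
theorem peval_eq_zero_of_ball {d : ℕ} {p : MvPolynomial (Fin d) ℝ} {r : ℝ} (hr : 0 < r)
    (h : ∀ x ∈ Metric.ball (0 : E d) r, peval p x = 0) : p = 0 := by
  have hopen : IsOpen ((WithLp.toLp 2 : (Fin d → ℝ) → E d) ⁻¹' Metric.ball 0 r) :=
    Metric.isOpen_ball.preimage (PiLp.continuous_toLp 2 _)
  obtain ⟨ε, hε, hsub⟩ := Metric.isOpen_iff.1 hopen 0 (by simpa using hr)
  refine MvPolynomial.funext_set (fun _ => Ioo (-ε) ε) (fun _ => Ioo_infinite (by linarith)) ?_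
  intro x hx
  have hx' : x ∈ Metric.ball (0 : Fin d → ℝ) ε := by
    rw [mem_ball_zero_iff, pi_norm_lt_iff hε]
    exact fun i => abs_lt.2 (hx i (mem_univ i))
  rw [map_zero]
  exact h _ (hsub hx')

/-- Equivalence of norms in finite dimension. The map from coordinates of polynomials of degree at
most `k` to L² of the small ball is linear and injective, hence bounded below, while values on the
unit ball are bounded by the coordinates. -/
theorem exists_inverse_ineq_ball (d k : ℕ) {ρ : ℝ} (hρ : 0 < ρ) :
    ∃ C : ℝ, 0 ≤ C ∧ ∀ p : MvPolynomial (Fin d) ℝ, p.totalDegree ≤ k →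
      ∀ x ∈ Metric.closedBall (0 : E d) 1,
        peval p x ^ 2 ≤ C * ∫ y in Metric.ball (0 : E d) ρ, peval p y ^ 2 := by
  set V := MvPolynomial.restrictTotalDegree (Fin d) ℝ k
  set μ := (volume : Measure (E d)).restrict (Metric.ball 0 ρ)
  have hmem : ∀ p : MvPolynomial (Fin d) ℝ, MemLp (peval p) 2 μ := fun p =>
    memLp_of_continuous_of_isBounded (continuous_peval p) Metric.isBounded_ball measurableSet_ball 2
  let T : V →ₗ[ℝ] Lp ℝ 2 μ :=
    { toFun := fun p => (hmem p).toLp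
      map_add' := fun p q => by
        rw [← MemLp.toLp_add]
        exact MemLp.toLp_congr _ _ (Eventually.of_forall fun x => by simp [peval])
      map_smul' := fun a p => by
        rw [RingHom.id_apply, ← MemLp.toLp_const_smul]
        exact MemLp.toLp_congr _ _ (Eventually.of_forall fun x => by simp [peval]) }
  let b := Module.finBasis ℝ V
  have hT : LinearMap.ker (T ∘ₗ b.equivFun.symm.toLinearMap) = ⊥ := by
    rw [LinearMap.ker_eq_bot']
    intro a ha
    rw [← b.equivFun.symm.map_eq_zero_iff]
    set p := b.equivFun.symm a
    have h1 : peval (p : MvPolynomial (Fin d) ℝ) =ᵐ[μ] 0 := by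
      have h2 : (hmem p).toLp = 0 := ha
      exact (hmem p).coeFn_toLp.symm.trans (by rw [h2]; exact Lp.coeFn_zero _ _ _)
    have h2 := Measure.eqOn_open_of_ae_eq h1 Metric.isOpen_ball
      (continuous_peval _).continuousOn continuousOn_const
    exact Subtype.ext (peval_eq_zero_of_ball hρ fun x hx => h2 hx)
  obtain ⟨K, -, hK⟩ := LinearMap.exists_antilipschitzWith _ hT
  have hbd : ∀ i, ∃ B : ℝ, ∀ x ∈ Metric.closedBall (0 : E d) 1,
      |peval (b i : MvPolynomial (Fin d) ℝ) x| ≤ B := fun i => by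
    obtain ⟨B, hB⟩ := ((isCompact_closedBall (0 : E d) 1).image
      (continuous_peval (b i : MvPolynomial (Fin d) ℝ))).isBounded.exists_norm_le
    exact ⟨B, fun x hx => hB _ ⟨x, hx, rfl⟩⟩
  choose B hB using hbd
  refine ⟨(∑ i, |B i|) ^ 2 * (K : ℝ) ^ 2, by positivity, fun p hp x hx => ?_⟩
  have hpV : p ∈ V := (MvPolynomial.mem_restrictTotalDegree _ _ _).2 hp
  set a := b.equivFun ⟨p, hpV⟩
  have hnorm : ‖a‖ ≤ K * ‖(hmem p).toLp‖ := by
    have := hK.le_mul_dist a 0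
    rw [map_zero, dist_zero_right, dist_zero_right] at this
    have e : (T ∘ₗ b.equivFun.symm.toLinearMap) a = (hmem p).toLp := by
      change T (b.equivFun.symm (b.equivFun ⟨p, hpV⟩)) = _
      rw [LinearEquiv.symm_apply_apply]; rfl
    rwa [e] at this
  have hpx : peval p x = ∑ i, a i * peval (b i : MvPolynomial (Fin d) ℝ) x := by
    have h1 := congrArg (Subtype.val) (b.sum_equivFun ⟨p, hpV⟩)
    have h2 : p = ∑ i, a i • (b i : MvPolynomial (Fin d) ℝ) := by
      have h3 : (∑ i, a i • (b i : MvPolynomial (Fin d) ℝ))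
          = ((∑ i, b.equivFun ⟨p, hpV⟩ i • b i : V) : MvPolynomial (Fin d) ℝ) := by
        rw [Submodule.coe_sum]; rfl
      rw [h3, h1]
    conv_lhs => rw [h2]
    simp [peval]
  have habs : |peval p x| ≤ (∑ i, |B i|) * ‖a‖ := by
    rw [hpx, Finset.sum_mul]
    refine (Finset.abs_sum_le_sum_abs _ _).trans (Finset.sum_le_sum fun i _ => ?_)
    rw [abs_mul, mul_comm]
    exact mul_le_mul ((hB i x hx).trans (le_abs_self _)) (norm_le_pi_norm a i) (abs_nonneg _)
      (abs_nonneg _)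
  have hsq : ‖(hmem p).toLp‖ ^ 2 = ∫ y in Metric.ball (0 : E d) ρ, peval p y ^ 2 := by
    rw [norm_sq_eq_integral]
    refine integral_congr_ae ((hmem p).coeFn_toLp.mono fun y hy => ?_)
    simp only [hy, Real.norm_eq_abs, sq_abs]
  rw [← hsq, ← sq_abs, mul_assoc, ← mul_pow, ← mul_pow]
  refine pow_le_pow_left₀ (abs_nonneg _) (habs.trans ?_) 2
  gcongr

theorem exists_peval_affine {d k : ℕ} {p : MvPolynomial (Fin d) ℝ} (hp : p.totalDegree ≤ k)
    (c : E d) (h : ℝ) :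
    ∃ q : MvPolynomial (Fin d) ℝ, q.totalDegree ≤ k ∧ ∀ x, peval q x = peval p (c + h • x) := by
  refine ⟨∑ m ∈ p.support, MvPolynomial.C (p.coeff m) *
    ∏ i ∈ m.support, (MvPolynomial.C (c i) + MvPolynomial.C h * MvPolynomial.X i) ^ m i, ?_, ?_⟩
  · refine MvPolynomial.totalDegree_finsetSum_le fun m hm => ?_
    refine (MvPolynomial.totalDegree_mul _ _).trans ?_
    rw [MvPolynomial.totalDegree_C, zero_add]
    refine (MvPolynomial.totalDegree_finsetProd _ _).trans (le_trans ?_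
      ((MvPolynomial.le_totalDegree hm).trans hp))
    refine Finset.sum_le_sum fun i _ => (MvPolynomial.totalDegree_pow _ _).trans ?_
    refine (Nat.mul_le_mul_left _ ((MvPolynomial.totalDegree_add _ _).trans (max_le ?_
      ((MvPolynomial.totalDegree_mul _ _).trans ?_)))).trans (mul_one (m i)).le
    · simp
    · simp
  · intro x
    rw [peval, peval, MvPolynomial.eval_eq _ p]
    simp

theorem totalDegree_pderiv_le {d : ℕ} (p : MvPolynomial (Fin d) ℝ) (a : Fin d) :
    (MvPolynomial.pderiv a p).totalDegree ≤ p.totalDegree := by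
  conv_lhs => rw [p.as_sum]
  rw [map_sum]
  refine MvPolynomial.totalDegree_finsetSum_le fun m hm => ?_
  rw [MvPolynomial.pderiv_monomial]
  refine (MvPolynomial.totalDegree_monomial_le _ _).trans
    (le_trans ?_ (MvPolynomial.le_totalDegree hm))
  rw [Finsupp.sum_fintype _ _ (fun _ => rfl), Finsupp.sum_fintype _ _ (fun _ => rfl)]
  exact Finset.sum_le_sum fun i _ => by simp

theorem hasFDerivAt_peval {d : ℕ} (p : MvPolynomial (Fin d) ℝ) (x : E d) :
    HasFDerivAt (peval p)
      (∑ a, peval (MvPolynomial.pderiv a p) x • (EuclideanSpace.proj a : E d →L[ℝ] ℝ)) x := by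
  induction p using MvPolynomial.induction_on with
  | C r =>
    have : peval (MvPolynomial.C r) = fun _ : E d => r := by ext; simp [peval]
    rw [this]
    simpa [peval] using hasFDerivAt_const r x
  | add p q hp hq =>
    have : peval (p + q) = fun y : E d => peval p y + peval q y := by ext; simp [peval]
    rw [this]
    convert! hp.add hq using 1
    rw [← Finset.sum_add_distrib]
    exact Finset.sum_congr rfl fun a _ => by simp [peval, add_smul]
  | mul_X p i hp =>
    have : peval (p * MvPolynomial.X i) = fun y : E d => peval p y * y i := by ext; simp [peval]
    rw [this]
    convert! hp.mul (EuclideanSpace.proj i : E d →L[ℝ] ℝ).hasFDerivAt using 1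
    ext v
    simp [peval, MvPolynomial.pderiv_X, Finset.mul_sum, Pi.single_apply, add_mul,
      Finset.sum_add_distrib]
    congr 1
    · rw [Finset.sum_eq_single i (fun j _ hj => by simp [Ne.symm hj]) (by simp)]
      simp
    · exact Finset.sum_congr rfl fun j _ => mul_assoc _ _ _

/-- The inverse inequality for polynomials, on a domain that is star-shaped with respect to a
ball. -/
theorem exists_inverse_ineq (d k : ℕ) {ρ : ℝ} (hρ : 0 < ρ) :
    ∃ C : ℝ, 0 ≤ C ∧ ∀ (K : Set (E d)) (c : E d) (h : ℝ), 0 < h → IsStarBall K c (ρ * h) h →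
      ∀ p : MvPolynomial (Fin d) ℝ, p.totalDegree ≤ k → ∀ x ∈ Metric.closedBall c h,
        |peval p x| * volume.real K
          ≤ C * (Real.sqrt (volume.real K) * Real.sqrt (∫ y in K, peval p y ^ 2)) := by
  obtain ⟨C, hC, hinv⟩ := exists_inverse_ineq_ball d k hρ
  set κ := volume.real (Metric.closedBall (0 : E d) 1) with hκ
  refine ⟨Real.sqrt (κ * C), Real.sqrt_nonneg _, fun K c h hh hK p hp x hx => ?_⟩
  obtain ⟨q, hqd, hq⟩ := exists_peval_affine hp c h
  have hbdd : Bornology.IsBounded K := hK.isBounded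
  have hball : Metric.ball c (ρ * h) ⊆ K := hK.ball_center_sub
  have h1 : peval p x ^ 2 ≤ C * ∫ y in Metric.ball (0 : E d) ρ, peval p (c + h • y) ^ 2 := by
    have := hinv q hqd (h⁻¹ • (x - c)) (by
      rw [mem_closedBall_zero_iff, norm_smul, norm_inv, Real.norm_of_nonneg hh.le,
        inv_mul_le_iff₀ hh, mul_one, ← dist_eq_norm]
      exact hx)
    simp only [hq] at this
    rwa [smul_smul, mul_inv_cancel₀ hh.ne', one_smul, add_sub_cancel] at this
  have h2 : ∫ y in Metric.ball (0 : E d) ρ, peval p (c + h • y) ^ 2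
      = (h ^ d)⁻¹ * ∫ y in Metric.ball c (ρ * h), peval p y ^ 2 := by
    rw [Measure.setIntegral_comp_smul_of_pos volume (fun y => peval p (c + y) ^ 2) _ hh]
    rw [smul_ball hh.ne', smul_zero, Real.norm_of_nonneg hh.le, smul_eq_mul, finrank_euclideanSpace,
      Fintype.card_fin]
    have := (measurePreserving_add_left (volume : Measure (E d)) c).setIntegral_preimage_emb
      (MeasurableEquiv.addLeft c).measurableEmbedding (fun y => peval p y ^ 2)
      (Metric.ball c (ρ * h))
    rw [← this, mul_comm h ρ]
    congr 3
    ext y; simp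
  have hpi : IntegrableOn (fun y => peval p y ^ 2) K :=
    memLp_one_iff_integrable.1 (memLp_of_continuous_of_isBounded ((continuous_peval p).pow 2) hbdd
      hK.isOpen.measurableSet 1)
  have h3 : ∫ y in Metric.ball c (ρ * h), peval p y ^ 2 ≤ ∫ y in K, peval p y ^ 2 :=
    setIntegral_mono_set hpi (Eventually.of_forall fun y => sq_nonneg _) hball.eventuallyLE
  have h4 : volume.real K ≤ h ^ d * κ := by
    refine (measureReal_mono hK.sub measure_closedBall_lt_top.ne).trans (le_of_eq ?_)
    rw [Measure.addHaar_real_closedBall' _ _ hh.le, finrank_euclideanSpace, Fintype.card_fin]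
  have h5 : 0 ≤ ∫ y in K, peval p y ^ 2 := integral_nonneg fun y => sq_nonneg _
  have hm : 0 ≤ volume.real K := measureReal_nonneg
  -- The factor h⁻ᵈ from the change of variables cancels the hᵈ in |K| ≤ κhᵈ, so the constant is
  -- free of `h`.
  have h6 : peval p x ^ 2 * volume.real K ≤ κ * C * ∫ y in K, peval p y ^ 2 := by
    have hd : 0 < h ^ d := by positivity
    calc peval p x ^ 2 * volume.real K
        ≤ (C * ((h ^ d)⁻¹ * ∫ y in K, peval p y ^ 2)) * (h ^ d * κ) := by
          refine mul_le_mul (h1.trans ?_) h4 hm (by positivity)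
          rw [h2]; gcongr
      _ = κ * C * ∫ y in K, peval p y ^ 2 := by field_simp
  rw [← Real.sqrt_mul hm, ← Real.sqrt_mul (by positivity)]
  refine Real.le_sqrt_of_sq_le ?_
  rw [mul_pow, sq_abs]
  nlinarith

/-- The oscillation of a polynomial is bounded by the `L²` norm of its gradient, on a domain that
is star-shaped with respect to a ball. -/
theorem exists_oscillation_ineq (d k : ℕ) {ρ : ℝ} (hρ : 0 < ρ) :
    ∃ C : ℝ, 0 ≤ C ∧ ∀ (K : Set (E d)) (c : E d) (h : ℝ), 0 < h → IsStarBall K c (ρ * h) h →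
      ∀ p : MvPolynomial (Fin d) ℝ, p.totalDegree ≤ k → ∀ x ∈ Metric.closedBall c h,
        |peval p x - peval p c| * volume.real K
          ≤ C * h * (Real.sqrt (volume.real K) *
            Real.sqrt (∫ y in K, ∑ a, peval (MvPolynomial.pderiv a p) y ^ 2)) := by
  obtain ⟨C, hC, hinv⟩ := exists_inverse_ineq d k hρ
  refine ⟨d * C, by positivity, fun K c h hh hK p hp x hx => ?_⟩
  have hbdd : Bornology.IsBounded K := hK.isBounded
  set m := volume.real K
  have hm : 0 ≤ m := measureReal_nonneg
  set D := Real.sqrt m * Real.sqrt (∫ y in K, ∑ a, peval (MvPolynomial.pderiv a p) y ^ 2)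
  rcases hm.eq_or_lt with h0 | h0
  · rw [← h0, mul_zero]; positivity
  have hpi : ∀ a, IntegrableOn (fun y => peval (MvPolynomial.pderiv a p) y ^ 2) K := fun a =>
    memLp_one_iff_integrable.1 (memLp_of_continuous_of_isBounded ((continuous_peval _).pow 2) hbdd
      hK.isOpen.measurableSet 1)
  -- The inverse inequality for the partial derivatives holds on the whole closed ball. That ball is
  -- convex, so the mean value inequality applies there although `K` need not be convex.
  have hder : ∀ y ∈ Metric.closedBall c h, ∀ a, |peval (MvPolynomial.pderiv a p) y| ≤ C * D / m := by
    intro y hy a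
    rw [le_div_iff₀ h0]
    refine (hinv K c h hh hK _ ((totalDegree_pderiv_le p a).trans hp) y hy).trans ?_
    refine mul_le_mul_of_nonneg_left (mul_le_mul_of_nonneg_left (Real.sqrt_le_sqrt ?_)
      (Real.sqrt_nonneg _)) hC
    rw [integral_finsetSum _ fun a _ => hpi a]
    exact Finset.single_le_sum (f := fun a => ∫ y in K, peval (MvPolynomial.pderiv a p) y ^ 2)
      (fun a _ => integral_nonneg fun y => sq_nonneg _) (Finset.mem_univ a)
  have hmv := (convex_closedBall c h).norm_image_sub_le_of_norm_hasFDerivWithin_le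
    (f := peval p) (C := d * (C * D / m)) (fun y _ => (hasFDerivAt_peval p y).hasFDerivWithinAt)
    (fun y hy => by
      refine (norm_sum_le _ _).trans ((Finset.sum_le_card_nsmul _ _ (C * D / m) fun a _ => ?_).trans
        (by simp))
      rw [norm_smul]
      refine (mul_le_of_le_one_right (norm_nonneg _) ?_).trans (hder y hy a)
      exact ContinuousLinearMap.opNorm_le_bound _ zero_le_one fun v => by
        rw [one_mul]; exact PiLp.norm_apply_le v a)
    (Metric.mem_closedBall_self hh.le) hx
  rw [Real.norm_eq_abs] at hmv
  have hxc : ‖x - c‖ ≤ h := by rw [← dist_eq_norm]; exact hx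
  calc |peval p x - peval p c| * m ≤ (d * (C * D / m) * h) * m := by
        refine mul_le_mul_of_nonneg_right (hmv.trans (mul_le_mul_of_nonneg_left hxc ?_)) hm
        positivity
    _ = d * C * h * D := by field_simp

/-! ### Polytopal sets and meshes -/

theorem IsPolytopal.isOpen {d : ℕ} {S : Set (E d)} (h : IsPolytopal S) : IsOpen S := by
  obtain ⟨T, -, rfl⟩ := h
  exact isOpen_interior

theorem IsPolytopal.isBounded {d : ℕ} {S : Set (E d)} (h : IsPolytopal S) :
    Bornology.IsBounded S := by
  obtain ⟨T, -, rfl⟩ := h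
  refine Bornology.IsBounded.subset ?_ interior_subset
  rw [Bornology.isBounded_biUnion_finset]
  exact fun t _ => isBounded_convexHull.2 (finite_range t).isBounded

/-- The frontier lies in the union of the frontiers of the simplices, and convex sets have null
frontiers. -/
theorem IsPolytopal.volume_frontier {d : ℕ} {S : Set (E d)} (h : IsPolytopal S) :
    volume (frontier S) = 0 := by
  classical
  obtain ⟨T, -, rfl⟩ := h
  refine measure_mono_null frontier_interior_subset ?_
  induction T using Finset.induction_on with
  | empty => simp
  | insert t T _ ih =>
    rw [Finset.set_biUnion_insert]
    refine measure_mono_null ((frontier_union_subset _ _).trans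
      (union_subset_union inter_subset_left inter_subset_right)) ?_
    exact measure_union_null ((convex_convexHull ℝ _).addHaar_frontier _) ih

namespace PolyMesh

variable {d : ℕ} {Ω : Set (E d)} {M : Type} [Fintype M] (T : PolyMesh Ω M)

/-- A point of Ω outside all the cells is in the closure of one of them, hence on its null frontier.
Integrals over Ω thus split over the cells. -/
theorem iUnion_cell_ae_eq : (⋃ K, T.cell K) =ᵐ[volume] Ω := by
  refine (LE.le.eventuallyLE (iUnion_subset T.sub)).antisymm ?_
  have h0 : volume (⋃ K, frontier (T.cell K)) = 0 :=
    measure_iUnion_null fun K => (T.poly K).volume_frontier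
  refine ae_le_set.2 (measure_mono_null (fun x hx => ?_) h0)
  have h1 : x ∈ ⋃ K, closure (T.cell K) := T.cover ▸ subset_closure hx.1
  obtain ⟨K, hK⟩ := mem_iUnion.1 h1
  refine mem_iUnion.2 ⟨K, ?_⟩
  rw [(T.poly K).isOpen.frontier_eq]
  exact ⟨hK, fun h => hx.2 (mem_iUnion.2 ⟨K, h⟩)⟩

theorem integral_eq_sum {f : E d → ℝ} (hf : ∀ K, IntegrableOn f (T.cell K)) :
    ∫ x in Ω, f x = ∑ K, ∫ x in T.cell K, f x := by
  rw [← setIntegral_congr_set T.iUnion_cell_ae_eq]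
  exact integral_iUnion_fintype (fun K => (T.poly K).isOpen.measurableSet)
    (fun K K' h => T.disj K K' h) hf

theorem sum_volume_cell : ∑ K, volume.real (T.cell K) = volume.real Ω := by
  have := T.integral_eq_sum (f := fun _ => (1 : ℝ)) fun K =>
    integrableOn_const (T.poly K).isBounded.measure_lt_top.ne
  simpa using this.symm

theorem diam_le_size (K : M) : Metric.diam (T.cell K) ≤ T.size :=
  le_ciSup (f := fun K => Metric.diam (T.cell K)) (Set.finite_range _).bddAbove K

theorem wNorm_le_brokenNorm (K : M) (s : ℕ) (g : E d → ℝ) :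
    wNorm (T.cell K) s g ≤ T.brokenNorm s g :=
  le_ciSup (f := fun K => wNorm (T.cell K) s g) (Set.finite_range _).bddAbove K

theorem size_nonneg : 0 ≤ T.size := Real.iSup_nonneg fun _ => Metric.diam_nonneg

theorem brokenNorm_nonneg (s : ℕ) (g : E d → ℝ) : 0 ≤ T.brokenNorm s g :=
  Real.iSup_nonneg fun _ => wNorm_nonneg _ _ _

/-- In dimension 0 a cell would be a single point; for d ≥ 1 an open set contains two distinct
points. -/
theorem diam_pos (hd : 1 ≤ d) (K : M) : 0 < Metric.diam (T.cell K) := by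
  obtain ⟨x, hx⟩ := (T.conn K).nonempty
  obtain ⟨ε, hε, hsub⟩ := Metric.isOpen_iff.1 (T.poly K).isOpen x hx
  set y : E d := x + (ε / 2) • EuclideanSpace.single ⟨0, hd⟩ 1
  have hxy : dist y x = ε / 2 := by
    rw [dist_eq_norm, add_sub_cancel_left, norm_smul, PiLp.norm_single, norm_one,
      mul_one, Real.norm_of_nonneg (by positivity)]
  have hy : y ∈ T.cell K := hsub (by rw [Metric.mem_ball, hxy]; linarith)
  have := Metric.dist_le_diam_of_mem (T.poly K).isBounded hy hx
  linarith

end PolyMesh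

/-! ### Local quadrature error -/

/-- The error of a quadrature rule on a continuous function. -/
theorem abs_quadrature_error_le {d : ℕ} {K : Set (E d)}
    (hK : Bornology.IsBounded K) {I : Type*} {J : Finset I} {m : I → ℝ} {y : I → E d}
    (hm : ∀ i ∈ J, 0 ≤ m i) (hy : ∀ i ∈ J, y i ∈ closure K)
    (hsum : ∑ i ∈ J, m i = volume.real K) {b : E d → ℝ} {η : ℝ}
    (hη : ∀ x ∈ closure K, |b x| ≤ η) :
    |∑ i ∈ J, m i * b (y i) - ∫ x in K, b x| ≤ 2 * volume.real K * η := by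
  have h1 : |∑ i ∈ J, m i * b (y i)| ≤ volume.real K * η := by
    rw [← hsum, Finset.sum_mul]
    refine (Finset.abs_sum_le_sum_abs _ _).trans (Finset.sum_le_sum fun i hi => ?_)
    rw [abs_mul, abs_of_nonneg (hm i hi)]
    exact mul_le_mul_of_nonneg_left (hη _ (hy i hi)) (hm i hi)
  have h2 : |∫ x in K, b x| ≤ volume.real K * η := by
    have := norm_setIntegral_le_of_norm_le_const (μ := volume) (f := b) (C := η)
      hK.measure_lt_top
      (fun x hx => hη x (subset_closure hx))
    rw [Real.norm_eq_abs] at this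
    linarith
  refine (abs_sub _ _).trans ?_
  linarith

/-- The error of a quadrature rule, exact at degree `k + l`, on the product of a function in
`W^{s,∞}(K)`, `s ≤ l + 2`, by a polynomial of degree at most `k`. -/
theorem exists_quadrature_bound (d k : ℕ) (hk : 1 ≤ k) {ρ : ℝ} (hρ : 0 < ρ) (l s : ℕ) (hs1 : 1 ≤ s)
    (hs2 : s ≤ l + 2) :
    ∃ C : ℝ, 0 ≤ C ∧ ∀ (K : Set (E d)) (c : E d) (h : ℝ), 0 < h → IsStarBall K c (ρ * h) h →
      ∀ (I : Type) (J : Finset I) (m : I → ℝ) (y : I → E d),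
      (∀ i ∈ J, 0 ≤ m i) → (∀ i ∈ J, y i ∈ closure K) →
      (∀ q : MvPolynomial (Fin d) ℝ, q.totalDegree ≤ k + l →
        ∫ x in K, peval q x = ∑ i ∈ J, m i * peval q (y i)) →
      ∀ (g gc : E d → ℝ) (L : NNReal), LipschitzWith L gc → g =ᵐ[volume.restrict K] gc →
      ∀ N : ℝ, 0 ≤ N → WeakBound K s N g →
      ∀ p : MvPolynomial (Fin d) ℝ, p.totalDegree ≤ k →
        |∑ i ∈ J, m i * (gc (y i) * peval p (y i)) - ∫ x in K, gc x * peval p x|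
          ≤ C * h ^ s * N * (Real.sqrt (volume.real K) * (Real.sqrt (∫ x in K, peval p x ^ 2)
            + Real.sqrt (∫ x in K, ∑ a, peval (MvPolynomial.pderiv a p) x ^ 2))) := by
  obtain ⟨A, hA, hinv⟩ := exists_inverse_ineq d k hρ
  obtain ⟨B, hB, hosc⟩ := exists_oscillation_ineq d k hρ
  refine ⟨2 * (d ^ s * A + d ^ (s - 1) * B), by positivity,
    fun K c h hh hK I J m y hm hy hex g gc L hL hgc N hN hW p hp => ?_⟩
  have hbdd := hK.isBounded
  have hKm := hK.isOpen.measurableSet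
  have hcl : closure K ⊆ Metric.closedBall c h := closure_minimal hK.sub Metric.isClosed_closedBall
  set V := volume.real K with hV
  have hV0 : 0 < V := by
    rw [hV, measureReal_def, ENNReal.toReal_pos_iff]
    exact ⟨hK.isOpen.measure_pos _ hK.nonempty, hbdd.measure_lt_top⟩
  set D₀ := Real.sqrt (∫ x in K, peval p x ^ 2)
  set D₁ := Real.sqrt (∫ x in K, ∑ a, peval (MvPolynomial.pderiv a p) x ^ 2)
  set P := B * h * (Real.sqrt V * D₁) / V with hP
  have hP0 : 0 ≤ P := by positivity
  have hPV : P * V = B * h * (Real.sqrt V * D₁) := div_mul_cancel₀ _ hV0.ne'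
  have hpc : |peval p c| * V ≤ A * (Real.sqrt V * D₀) :=
    hinv K c h hh hK p hp c (Metric.mem_closedBall_self hh.le)
  have hpP : ∀ x ∈ closure K, |peval p x - peval p c| ≤ P := fun x hx => by
    rw [hP, le_div_iff₀ hV0]
    exact hosc K c h hh hK p hp x (hcl hx)
  have hsum : ∑ i ∈ J, m i = V := by
    have := hex 1 (by simp)
    simpa [peval] using this.symm
  set X := |peval p c| with hX
  have key : ∀ δ : ℝ, 0 < δ →
      |∑ i ∈ J, m i * (gc (y i) * peval p (y i)) - ∫ x in K, gc x * peval p x|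
        ≤ 2 * V * (X * (d ^ s * h ^ s * N + δ)) + 2 * V * ((d ^ (s - 1) * h ^ (s - 1) * N + δ) * P)
      := by
    intro δ hδ
    -- Two approximations of the same function: `q₁` of order s, to be multiplied by the constant
    -- p(c), and `q₂` of order s - 1, to be multiplied by p - p(c). Then gc·p = b₁ + b₂ + Q, and the
    -- rule is exact on Q.
    obtain ⟨q₁, hq₁d, hq₁⟩ := exists_peval_approx hK hL hgc hW hN hδ
    obtain ⟨q₂, hq₂d, hq₂⟩ := exists_peval_approx hK hL hgc
      (hW.mono (Nat.sub_le s 1) le_rfl) hN hδ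
    set b₁ : E d → ℝ := fun x => peval p c * (gc x - peval q₁ x) with hb₁
    set b₂ : E d → ℝ := fun x => (gc x - peval q₂ x) * (peval p x - peval p c) with hb₂
    set Q : MvPolynomial (Fin d) ℝ :=
      MvPolynomial.C (peval p c) * q₁ + q₂ * (p - MvPolynomial.C (peval p c)) with hQ
    have hQe : ∀ x, peval Q x = peval p c * peval q₁ x + peval q₂ x * (peval p x - peval p c) := by
      intro x
      rw [hQ]
      simp [peval]
    -- The first term has degree at most s - 1 ≤ l + 1 ≤ k + l, by k ≥ 1. The second has degree at
    -- most (s - 2) + k ≤ k + l, with truncated subtraction when s = 1.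
    have hQd : Q.totalDegree ≤ k + l := by
      refine (MvPolynomial.totalDegree_add _ _).trans (max_le ?_ ?_)
      · refine (MvPolynomial.totalDegree_mul _ _).trans ?_
        rw [MvPolynomial.totalDegree_C]
        omega
      · refine (MvPolynomial.totalDegree_mul _ _).trans ?_
        have := MvPolynomial.totalDegree_sub_C_le p (peval p c)
        omega
    have hdec : ∀ x, gc x * peval p x = b₁ x + b₂ x + peval Q x := by
      intro x
      rw [hQe, hb₁, hb₂]
      ring
    have hgcc := hL.continuous
    have hint : ∀ b : E d → ℝ, Continuous b → IntegrableOn b K := fun b hb =>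
      memLp_one_iff_integrable.1 (memLp_of_continuous_of_isBounded hb hbdd hKm 1)
    have hi₁ : IntegrableOn b₁ K :=
      hint _ (continuous_const.mul (hgcc.sub (continuous_peval _)))
    have hi₂ : IntegrableOn b₂ K :=
      hint _ ((hgcc.sub (continuous_peval _)).mul ((continuous_peval _).sub continuous_const))
    have hiQ : IntegrableOn (peval Q) K := hint _ (continuous_peval _)
    have hE : ∑ i ∈ J, m i * (gc (y i) * peval p (y i)) - ∫ x in K, gc x * peval p x
        = (∑ i ∈ J, m i * b₁ (y i) - ∫ x in K, b₁ x)
          + (∑ i ∈ J, m i * b₂ (y i) - ∫ x in K, b₂ x) := by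
      simp only [hdec]
      rw [integral_add (f := fun x => b₁ x + b₂ x) (hi₁.add hi₂) hiQ,
        integral_add hi₁ hi₂, hex Q hQd]
      simp only [mul_add, Finset.sum_add_distrib]
      ring
    rw [hE]
    refine (abs_add_le _ _).trans (add_le_add ?_ ?_)
    · refine abs_quadrature_error_le hbdd hm hy hsum fun x hx => ?_
      rw [hb₁, abs_mul]
      exact mul_le_mul_of_nonneg_left (hq₁ x hx) (abs_nonneg _)
    · refine abs_quadrature_error_le hbdd hm hy hsum fun x hx => ?_
      rw [hb₂, abs_mul]
      exact mul_le_mul (hq₂ x hx) (hpP x hx) (abs_nonneg _) (by positivity)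
  have hX0 : 0 ≤ X := abs_nonneg _
  -- The weights and `P` do not depend on δ, which can therefore be made to vanish.
  have hmain : |∑ i ∈ J, m i * (gc (y i) * peval p (y i)) - ∫ x in K, gc x * peval p x|
      ≤ 2 * V * (X * (d ^ s * h ^ s * N)) + 2 * V * ((d ^ (s - 1) * h ^ (s - 1) * N) * P) := by
    refine le_of_forall_pos_le_add fun ε hε => ?_
    have hY : 0 < 2 * V * (X + P) + 1 := by positivity
    refine (key (ε / (2 * V * (X + P) + 1)) (by positivity)).trans ?_
    have : ε / (2 * V * (X + P) + 1) * (2 * V * (X + P)) ≤ ε := by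
      rw [div_mul_eq_mul_div, div_le_iff₀ hY]
      nlinarith
    linarith
  refine hmain.trans ?_
  have hhs : h ^ (s - 1) * h = h ^ s := by rw [← pow_succ, Nat.sub_add_cancel hs1]
  have e1 : 2 * V * (X * (d ^ s * h ^ s * N)) ≤ 2 * (d ^ s * h ^ s * N) * (A * (Real.sqrt V * D₀)) := by
    calc 2 * V * (X * (d ^ s * h ^ s * N)) = 2 * (d ^ s * h ^ s * N) * (X * V) := by ring
      _ ≤ _ := by gcongr
  have e2 : 2 * V * ((d ^ (s - 1) * h ^ (s - 1) * N) * P)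
      = 2 * (d ^ (s - 1) * h ^ s * N) * (B * (Real.sqrt V * D₁)) := by
    calc 2 * V * ((d ^ (s - 1) * h ^ (s - 1) * N) * P)
        = 2 * (d ^ (s - 1) * h ^ (s - 1) * N) * (P * V) := by ring
      _ = _ := by rw [hPV, ← hhs]; ring
  rw [e2]
  refine (add_le_add_left e1 _).trans ?_
  have f1 : 0 ≤ 2 * (d ^ s * h ^ s * N) * (A * (Real.sqrt V * D₁)) := by positivity
  have f2 : 0 ≤ 2 * (d ^ (s - 1) * h ^ s * N) * (B * (Real.sqrt V * D₀)) := by positivity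
  linarith

/-! ### The diffusion form -/

/-- The action of a symmetric matrix with eigenvalues in `[lo, hi]`. -/
theorem matrix_bounds {d : ℕ} {A : Matrix (Fin d) (Fin d) ℝ} (hA : A.IsSymm) {lo hi : ℝ}
    (hlo : 0 ≤ lo)
    (h : ∀ μ : ℝ, Module.End.HasEigenvalue (Matrix.toLin' A) μ → μ ∈ Icc lo hi) (y : E d) :
    lo * ‖y‖ ^ 2 ≤ inner ℝ (Matrix.toEuclideanLin A y) y ∧
      ‖Matrix.toEuclideanLin A y‖ ^ 2 ≤ (hi * ‖y‖) ^ 2 := by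
  have hT : (Matrix.toEuclideanLin A).IsSymmetric := Matrix.isSymmetric_toEuclideanLin_iff.2 (by
    rw [Matrix.IsHermitian, Matrix.conjTranspose_eq_transpose_of_trivial]; exact hA)
  have hn : Module.finrank ℝ (E d) = d := by simp
  set b := hT.eigenvectorBasis hn
  set ev := hT.eigenvalues hn
  -- The spectral theorem concerns the Euclidean operator, the hypothesis the one on plain
  -- coordinate vectors; an eigenvector of the former is one of the latter.
  have hev : ∀ i, ev i ∈ Icc lo hi := by
    intro i
    refine h _ ?_
    obtain ⟨v, hv⟩ := (hT.hasEigenvalue_eigenvalues hn i).exists_hasEigenvector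
    refine Module.End.hasEigenvalue_of_hasEigenvector (x := (v : Fin d → ℝ))
      ⟨Module.End.mem_eigenspace_iff.2 ?_, fun h0 => hv.2 (by ext a; exact congrFun h0 a)⟩
    have h1 := Module.End.mem_eigenspace_iff.1 hv.1
    have h2 := congrArg (fun z : E d => (z : Fin d → ℝ)) h1
    simpa [Matrix.toLpLin_apply] using h2
  have hrep : ∀ i, b.repr (Matrix.toEuclideanLin A y) i = ev i * b.repr y i := fun i =>
    hT.eigenvectorBasis_apply_self_apply hn y i
  have hy : ‖y‖ ^ 2 = ∑ i, b.repr y i ^ 2 := by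
    rw [← b.repr.norm_map y, EuclideanSpace.norm_sq_eq]
    simp
  constructor
  · rw [← b.repr.inner_map_map, hy, PiLp.inner_apply, Finset.mul_sum]
    refine Finset.sum_le_sum fun i _ => ?_
    rw [hrep]
    have := mul_le_mul_of_nonneg_right (hev i).1 (sq_nonneg (b.repr y i))
    refine this.trans (le_of_eq ?_)
    simp; ring
  · rw [mul_pow, hy, ← b.repr.norm_map (Matrix.toEuclideanLin A y), EuclideanSpace.norm_sq_eq,
      Finset.mul_sum]
    refine Finset.sum_le_sum fun i _ => ?_
    rw [hrep, norm_mul, mul_pow, Real.norm_eq_abs, Real.norm_eq_abs, sq_abs, sq_abs]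
    exact mul_le_mul_of_nonneg_right
      (pow_le_pow_left₀ (hlo.trans (hev i).1) (hev i).2 2) (sq_nonneg _)

namespace IsDiffusion

variable {d : ℕ} {Ω : Set (E d)} {lo hi : ℝ} {Λ : E d → Matrix (Fin d) (Fin d) ℝ}

theorem norm_matField_le (h : IsDiffusion Ω lo hi Λ) (hlo : 0 ≤ lo) (hhi : 0 ≤ hi)
    (X : E d → E d) :
    ∀ᵐ x ∂(volume.restrict Ω), ‖matField Λ X x‖ ≤ hi * ‖X x‖ := by
  filter_upwards [h.symm, h.eig] with x h1 h2
  exact (pow_le_pow_iff_left₀ (norm_nonneg _) (by positivity) two_ne_zero).1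
    (matrix_bounds h1 hlo h2 (X x)).2

theorem memLp_matField (h : IsDiffusion Ω lo hi Λ) (hlo : 0 ≤ lo) (hhi : 0 ≤ hi) (X : L2v Ω) :
    MemLp (matField Λ X) 2 (volume.restrict Ω) := by
  refine MemLp.of_le_mul (Lp.memLp X) ?_ (h.norm_matField_le hlo hhi X)
  refine AEMeasurable.aestronglyMeasurable ?_
  have hX : AEMeasurable (fun x => X x) (volume.restrict Ω) :=
    (Lp.aestronglyMeasurable X).aemeasurable
  have hXb : ∀ b, AEMeasurable (fun x => X x b) (volume.restrict Ω) := fun b =>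
    (EuclideanSpace.proj b : E d →L[ℝ] ℝ).measurable.comp_aemeasurable hX
  have : matField Λ X = fun x => WithLp.toLp 2 (fun a => ∑ b, Λ x a b * X x b) := by
    ext x a
    simp [matField, Matrix.toLpLin_apply, Matrix.mulVec, dotProduct]
  rw [this]
  refine (WithLp.measurable_toLp 2 (Fin d → ℝ)).comp_aemeasurable (aemeasurable_pi_iff.2 fun a => ?_)
  exact Finset.aemeasurable_fun_sum _ fun b _ => (h.meas a b).mul (hXb b)

/-- The form `(X, Z) ↦ ∫_Ω Λ X · Z` is additive in `X`. -/
theorem integral_matField_sub (h : IsDiffusion Ω lo hi Λ) (hlo : 0 ≤ lo) (hhi : 0 ≤ hi)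
    (X Y Z : L2v Ω) :
    ∫ x in Ω, inner ℝ (matField Λ (X - Y : L2v Ω) x) (Z x)
      = (∫ x in Ω, inner ℝ (matField Λ X x) (Z x)) - ∫ x in Ω, inner ℝ (matField Λ Y x) (Z x) := by
  have hi' : ∀ X : L2v Ω, Integrable (fun x => inner ℝ (matField Λ X x) (Z x))
      (volume.restrict Ω) := fun X => by
    refine (L2.integrable_inner (𝕜 := ℝ) (h.memLp_matField hlo hhi X).toLp Z).congr ?_
    filter_upwards [(h.memLp_matField hlo hhi X).coeFn_toLp] with x hx
    rw [hx]
  rw [← integral_sub (hi' X) (hi' Y)]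
  refine integral_congr_ae ?_
  filter_upwards [Lp.coeFn_sub X Y] with x hx
  simp only [matField, hx, Pi.sub_apply, map_sub, inner_sub_left]

theorem abs_integral_matField_le (h : IsDiffusion Ω lo hi Λ) (hlo : 0 ≤ lo) (hhi : 0 ≤ hi)
    (X Z : L2v Ω) :
    |∫ x in Ω, inner ℝ (matField Λ X x) (Z x)| ≤ hi * ‖X‖ * ‖Z‖ := by
  set P := (h.memLp_matField hlo hhi X).toLp
  have hP : ∫ x in Ω, inner ℝ (matField Λ X x) (Z x) = inner ℝ P Z := by
    rw [L2.inner_def]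
    refine integral_congr_ae ?_
    filter_upwards [(h.memLp_matField hlo hhi X).coeFn_toLp] with x hx
    rw [hx]
  rw [hP]
  refine (abs_real_inner_le_norm P Z).trans (mul_le_mul_of_nonneg_right ?_ (norm_nonneg _))
  refine Lp.norm_le_mul_norm_of_ae_le_mul ?_
  filter_upwards [(h.memLp_matField hlo hhi X).coeFn_toLp, h.norm_matField_le hlo hhi X]
    with x hx h2
  rwa [hx]

theorem le_integral_matField_self (h : IsDiffusion Ω lo hi Λ) (hlo : 0 ≤ lo) (hhi : 0 ≤ hi)
    (X : L2v Ω) :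
    lo * ‖X‖ ^ 2 ≤ ∫ x in Ω, inner ℝ (matField Λ X x) (X x) := by
  rw [norm_sq_eq_integral, ← integral_const_mul]
  refine integral_mono_ae ?_ ?_ ?_
  · exact ((Lp.memLp X).integrable_norm_pow two_ne_zero).const_mul lo
  · refine (L2.integrable_inner (𝕜 := ℝ) (h.memLp_matField hlo hhi X).toLp X).congr ?_
    filter_upwards [(h.memLp_matField hlo hhi X).coeFn_toLp] with x hx
    rw [hx]
  · filter_upwards [h.symm, h.eig] with x h1 h2
    exact (matrix_bounds h1 hlo h2 (X x)).1

end IsDiffusion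

/-! ### Weak divergence and broken regularity -/

theorem integral_sub_mul {α : Type*} [MeasurableSpace α] {μ : Measure α} {a b φ : α → ℝ}
    (ha : MemLp a 2 μ) (hb : MemLp b 2 μ) (hφ : MemLp φ 2 μ) :
    ∫ x, (a x - b x) * φ x ∂μ = (∫ x, a x * φ x ∂μ) - ∫ x, b x * φ x ∂μ := by
  rw [← integral_sub (f := fun x => a x * φ x) (g := fun x => b x * φ x)
    (ha.integrable_mul hφ) (hb.integrable_mul hφ)]
  simp only [sub_mul]

theorem memLp_of_isTest {d : ℕ} {Ω S : Set (E d)} {φ : E d → ℝ} (hφ : IsTest S φ) :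
    MemLp φ 2 (volume.restrict Ω) :=
  (hφ.smooth.continuous.memLp_of_hasCompactSupport hφ.compact).restrict Ω

theorem memLp_gradient_of_isTest {d : ℕ} {Ω S : Set (E d)} {φ : E d → ℝ} (hφ : IsTest S φ) :
    MemLp (gradient φ) 2 (volume.restrict Ω) := by
  have hc : Continuous (gradient φ) := (InnerProductSpace.toDual ℝ (E d)).symm.continuous.comp
    (hφ.smooth.continuous_fderiv (by simp))
  have hs : HasCompactSupport (gradient φ) :=
    (hφ.compact.fderiv ℝ).comp_left (g := (InnerProductSpace.toDual ℝ (E d)).symm) (map_zero _)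
  exact (hc.memLp_of_hasCompactSupport hs).restrict Ω

/-- The weak divergence is unique. -/
theorem IsWeakDiv.ae_eq {d : ℕ} {Ω : Set (E d)} (hΩ : IsOpen Ω) {ψ : E d → E d} {g₁ g₂ : L2 Ω}
    (h₁ : IsWeakDiv Ω ψ g₁) (h₂ : IsWeakDiv Ω ψ g₂) : g₁ =ᵐ[volume.restrict Ω] g₂ := by
  have hloc : ∀ g : L2 Ω, LocallyIntegrableOn g Ω := fun g =>
    locallyIntegrableOn_of_locallyIntegrable_restrict ((Lp.memLp g).locallyIntegrable (by norm_num))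
  have hint : ∀ (g : L2 Ω) (φ : E d → ℝ), IsTest Ω φ →
      Integrable (fun x => g x * φ x) (volume.restrict Ω) := fun g φ hφ =>
    (Lp.memLp g).integrable_mul (memLp_of_isTest hφ)
  have key := hΩ.ae_eq_zero_of_integral_contDiff_smul_eq_zero (μ := volume)
    (f := fun x => g₁ x - g₂ x) ((hloc g₁).sub (hloc g₂)) fun φ h1 h2 h3 => by
    have ht : IsTest Ω φ := ⟨h1, h2, h3⟩
    have e1 := h₁ φ ht
    have e2 := h₂ φ ht
    rw [← setIntegral_eq_integral_of_forall_compl_eq_zero (s := Ω) (fun x hx => by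
      rw [image_eq_zero_of_notMem_tsupport fun h => hx (h3 h), zero_smul])]
    have : ∀ x, φ x • (g₁ x - g₂ x) = g₁ x * φ x - g₂ x * φ x := fun x => by
      rw [smul_eq_mul]; ring
    simp only [this]
    rw [integral_sub (hint _ _ ht) (hint _ _ ht)]
    linarith
  rw [EventuallyEq, ae_restrict_iff' hΩ.measurableSet]
  filter_upwards [key] with x hx hxΩ using sub_eq_zero.1 (hx hxΩ)

/-- The flux of the weak solution has the weak divergence `β(u) - f`. -/
theorem IsWeakSol.weakDiv_ae_eq {d : ℕ} {Ω : Set (E d)} (hΩ : IsOpen Ω) {ζ β : ℝ → ℝ}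
    {Λ : E d → Matrix (Fin d) (Fin d) ℝ} {f u : L2 Ω} {G : L2v Ω}
    (h : IsWeakSol Ω ζ β Λ f 0 u G) (hβ : MemLp (fun x => β (u x)) 2 (volume.restrict Ω)) :
    weakDiv Ω (matField Λ G) =ᵐ[volume.restrict Ω] fun x => β (u x) - f x := by
  set g : L2 Ω := hβ.toLp - f
  have hg : g =ᵐ[volume.restrict Ω] fun x => β (u x) - f x := by
    filter_upwards [Lp.coeFn_sub hβ.toLp f, hβ.coeFn_toLp] with x h1 h2
    rw [h1, Pi.sub_apply, h2]
  have hgd : IsWeakDiv Ω (matField Λ G) g := by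
    intro φ hφ
    have hp := memLp_of_isTest (Ω := Ω) hφ
    have hq := memLp_gradient_of_isTest (Ω := Ω) hφ
    -- A test function with its gradient belongs to the set whose closure is `H10`, so it is
    -- admissible in the weak formulation.
    have h1 := h.2 (hp.toLp φ) (hq.toLp _) (subset_closure ⟨φ, hφ, hp.coeFn_toLp, hq.coeFn_toLp⟩)
    have e1 : ∫ x in Ω, β (u x) * (hp.toLp φ) x = ∫ x in Ω, β (u x) * φ x :=
      integral_congr_ae (hp.coeFn_toLp.mono fun x hx => by simp only [hx])
    have e2 : ∫ x in Ω, inner ℝ (matField Λ G x) ((hq.toLp _) x)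
        = ∫ x in Ω, inner ℝ (matField Λ G x) (gradient φ x) :=
      integral_congr_ae (hq.coeFn_toLp.mono fun x hx => by simp only [hx])
    have e3 : ∫ x in Ω, f x * (hp.toLp φ) x = ∫ x in Ω, f x * φ x :=
      integral_congr_ae (hp.coeFn_toLp.mono fun x hx => by simp only [hx])
    have e4 : ∫ x in Ω, inner ℝ ((0 : L2v Ω) x) ((hq.toLp _) x) = 0 := by
      rw [← integral_zero (E d) ℝ (μ := volume.restrict Ω)]
      refine integral_congr_ae ((Lp.coeFn_zero (E d) 2 (volume.restrict Ω)).mono fun x hx => ?_)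
      simp only [hx, Pi.zero_apply, inner_zero_left]
    have e5 : ∫ x in Ω, g x * φ x = (∫ x in Ω, β (u x) * φ x) - ∫ x in Ω, f x * φ x := by
      rw [← integral_sub_mul hβ (Lp.memLp f) hp]
      exact integral_congr_ae (hg.mono fun x hx => by simp only [hx])
    rw [e1, e2, e3, e4] at h1
    linarith
  -- `weakDiv` is a chosen divergence; uniqueness identifies it with `g`.
  have hex : ∃ g : L2 Ω, IsWeakDiv Ω (matField Λ G) g := ⟨g, hgd⟩
  rw [weakDiv, dif_pos hex]
  exact (hex.choose_spec.ae_eq hΩ hgd).trans hg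

/-- `IsWeakPartial` does not include integrability. The L² hypotheses make the products with test
functions integrable, as the linearity of the integral requires. -/
theorem MemW.sub {d : ℕ} {K : Set (E d)} (hK : volume K < ⊤) {s : ℕ} {g₁ g₂ : E d → ℝ}
    (hg₁ : MemLp g₁ 2 (volume.restrict K)) (hg₂ : MemLp g₂ 2 (volume.restrict K))
    (h₁ : MemW K s g₁) (h₂ : MemW K s g₂) : MemW K s (fun x => g₁ x - g₂ x) := by
  have : IsFiniteMeasure (volume.restrict K) := ⟨by rwa [Measure.restrict_apply_univ]⟩
  intro n hn j
  obtain ⟨a, ha, hwa⟩ := h₁ n hn j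
  obtain ⟨b, hb, hwb⟩ := h₂ n hn j
  refine ⟨fun x => a x - b x, ha.sub hb, fun φ hφ => ?_⟩
  set ψ : E d → ℝ := fun x => iteratedFDeriv ℝ n φ x (fun m => EuclideanSpace.single (j m) 1)
  have hψc : Continuous ψ := (ContinuousMultilinearMap.apply ℝ (fun _ : Fin n => E d) ℝ
    (fun m => EuclideanSpace.single (j m) 1)).continuous.comp
      (hφ.smooth.continuous_iteratedFDeriv (by exact_mod_cast le_top))
  have hψs : HasCompactSupport ψ := (hφ.compact.iteratedFDeriv n).comp_left
    (g := fun A : ContinuousMultilinearMap ℝ (fun _ : Fin n => E d) ℝ =>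
      A (fun m => EuclideanSpace.single (j m) 1)) rfl
  have hψ : MemLp ψ 2 (volume.restrict K) := (hψc.memLp_of_hasCompactSupport hψs).restrict K
  have hφ2 : MemLp φ 2 (volume.restrict K) := memLp_of_isTest hφ
  have ea := hwa φ hφ
  have eb := hwb φ hφ
  rw [integral_sub_mul hg₁ hg₂ hψ, ea, eb, integral_sub_mul (ha.mono_exponent le_top)
    (hb.mono_exponent le_top) hφ2]
  ring

/-! ### Poincaré constant and conformity defect -/

namespace GradDisc

variable {d : ℕ} {Ω : Set (E d)} {I : Type} {bd : Set I} (D : GradDisc Ω (X0 bd))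

/-- The space is finite-dimensional and `grad` is injective, so ‖grad v‖ controls every linear map.
This makes the set in `poincare` bounded above. -/
theorem exists_norm_recon_le [Fintype I] : ∃ B : ℝ, ∀ v : X0 bd, ‖D.recon v‖ ≤ B * ‖D.grad v‖ := by
  have hker : LinearMap.ker D.grad = ⊥ :=
    LinearMap.ker_eq_bot'.2 fun v hv => D.norm_grad v (by rw [hv, norm_zero])
  obtain ⟨K, -, hK⟩ := D.grad.exists_antilipschitzWith hker
  refine ⟨‖LinearMap.toContinuousLinearMap D.recon‖ * K, fun v => ?_⟩
  have h1 : ‖v‖ ≤ K * ‖D.grad v‖ := by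
    simpa using hK.le_mul_dist v 0
  have h2 := (LinearMap.toContinuousLinearMap D.recon).le_opNorm v
  rw [mul_assoc]
  exact h2.trans (mul_le_mul_of_nonneg_left h1 (norm_nonneg _))

/-- A real `sSup` dominates its set only if that set is bounded above. The constant `B` serves this
purpose alone and does not enter the conclusion; v = 0, which is not in the set, is covered by
`hr0`. -/
theorem le_sSup_mul_norm_grad {r : X0 bd → ℝ} {B : ℝ} (hr : ∀ v, r v ≤ B * ‖D.grad v‖)
    (hr0 : r 0 = 0) (v : X0 bd) :
    r v ≤ sSup {t | ∃ v : X0 bd, v ≠ 0 ∧ t = r v / ‖D.grad v‖} * ‖D.grad v‖ := by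
  have hpos : ∀ v : X0 bd, v ≠ 0 → 0 < ‖D.grad v‖ := fun v hv =>
    (norm_nonneg _).lt_of_ne' fun h => hv (D.norm_grad v h)
  rcases eq_or_ne v 0 with rfl | hv
  · simp [hr0]
  · rw [← div_le_iff₀ (hpos v hv)]
    refine le_csSup ⟨B, ?_⟩ ⟨v, hv, rfl⟩
    rintro _ ⟨w, hw, rfl⟩
    exact (div_le_iff₀ (hpos w hw)).2 (hr w)

theorem norm_recon_le [Fintype I] (v : X0 bd) : ‖D.recon v‖ ≤ D.poincare * ‖D.grad v‖ :=
  let ⟨_, hB⟩ := D.exists_norm_recon_le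
  D.le_sSup_mul_norm_grad (r := fun v => ‖D.recon v‖) hB (by simp) v

theorem poincare_nonneg : 0 ≤ D.poincare :=
  Real.sSup_nonneg (by rintro _ ⟨v, -, rfl⟩; positivity)

theorem defect_nonneg (ψ : E d → E d) : 0 ≤ D.defect ψ :=
  Real.sSup_nonneg (by rintro _ ⟨v, -, rfl⟩; positivity)

theorem integral_defect_eq {ψ : E d → E d} (hψ : MemLp ψ 2 (volume.restrict Ω)) (v : X0 bd) :
    ∫ x in Ω, (inner ℝ (D.grad v x) (ψ x) + D.recon v x * weakDiv Ω ψ x)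
      = (∫ x in Ω, inner ℝ (D.grad v x) (ψ x)) + ∫ x in Ω, D.recon v x * weakDiv Ω ψ x := by
  refine integral_add ?_ ((Lp.memLp (D.recon v)).integrable_mul (Lp.memLp (weakDiv Ω ψ)))
  refine (L2.integrable_inner (𝕜 := ℝ) (D.grad v) hψ.toLp).congr ?_
  filter_upwards [hψ.coeFn_toLp] with x hx
  rw [hx]

/-- Cauchy-Schwarz and the discrete Poincaré inequality bound the quotients by ‖ψ‖ + C_D‖div ψ‖, so
the supremum is a genuine one. -/
theorem abs_integral_le_defect [Fintype I] {ψ : E d → E d} (hψ : MemLp ψ 2 (volume.restrict Ω)) (v : X0 bd) :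
    |∫ x in Ω, (inner ℝ (D.grad v x) (ψ x) + D.recon v x * weakDiv Ω ψ x)|
      ≤ D.defect ψ * ‖D.grad v‖ := by
  have heq : ∀ v : X0 bd, ∫ x in Ω, (inner ℝ (D.grad v x) (ψ x) + D.recon v x * weakDiv Ω ψ x)
      = inner ℝ (D.grad v) (hψ.toLp ψ) + inner ℝ (D.recon v) (weakDiv Ω ψ) := fun v => by
    rw [D.integral_defect_eq hψ, L2.inner_def, L2.inner_def]
    congr 1
    · refine integral_congr_ae ?_
      filter_upwards [hψ.coeFn_toLp] with x hx
      rw [hx]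
    · refine integral_congr_ae (Eventually.of_forall fun x => ?_)
      simp [mul_comm]
  refine D.le_sSup_mul_norm_grad (B := ‖hψ.toLp ψ‖ + D.poincare * ‖weakDiv Ω ψ‖)
    (r := fun v => |∫ x in Ω, (inner ℝ (D.grad v x) (ψ x) + D.recon v x * weakDiv Ω ψ x)|)
    (fun v => ?_) (by simp only [heq]; simp) v
  rw [heq]
  have h1 := abs_real_inner_le_norm (D.grad v) (hψ.toLp ψ)
  have h2 := abs_real_inner_le_norm (D.recon v) (weakDiv Ω ψ)
  have h3 := mul_le_mul_of_nonneg_right (D.norm_recon_le v) (norm_nonneg (weakDiv Ω ψ))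
  refine (abs_add_le _ _).trans ?_
  linarith

end GradDisc

/-! ### Monotonicity at the nodes -/

/-- Essential limits of monotone functions of `u` are ordered consistently. -/
theorem mul_nodalValue_sub_nonneg {d : ℕ} {Ω K : Set (E d)} (hK : IsOpen K) (hKΩ : K ⊆ Ω)
    {ζ β : ℝ → ℝ} (hζ : Monotone ζ) (hβ : Monotone β) {u : E d → ℝ} {x : E d} {a : ℝ}
    (ha : HasNodalValue Ω (fun x => ζ (u x)) x a) (hx : x ∈ closure K) {b : E d → ℝ}
    (hb : Continuous b) (hub : (fun x => β (u x)) =ᵐ[volume.restrict K] b) (r : ℝ) :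
    0 ≤ (b x - β r) * (a - ζ r) := by
  -- Every neighbourhood of a point of the closure of `K` meets the open set `K` in positive
  -- measure, so limits along this filter are meaningful.
  have hne : (𝓝 x ⊓ ae (volume.restrict K)).NeBot := by
    rw [Filter.inf_neBot_iff]
    intro s hs t ht
    obtain ⟨o, hos, ho, hxo⟩ := mem_nhds_iff.1 hs
    obtain ⟨y, hyo, hyK⟩ := mem_closure_iff.1 hx o ho hxo
    by_contra hemp
    have hsub : o ∩ K ⊆ tᶜ ∩ K := fun w hw => ⟨fun hwt => hemp ⟨w, hos hw.1, hwt⟩, hw.2⟩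
    have h0 : volume (tᶜ ∩ K) = 0 := by
      have h1 : (volume.restrict K) tᶜ = 0 := ht
      rwa [Measure.restrict_apply' hK.measurableSet] at h1
    exact ((ho.inter hK).measure_pos volume ⟨y, hyo, hyK⟩).ne' (measure_mono_null hsub h0)
  have h1 : Tendsto (fun x => ζ (u x)) (𝓝 x ⊓ ae (volume.restrict K)) (𝓝 a) :=
    ha.mono_left (inf_le_inf_left _ (ae_mono (Measure.restrict_mono hKΩ le_rfl)))
  have h2 : Tendsto (fun x => β (u x)) (𝓝 x ⊓ ae (volume.restrict K)) (𝓝 (b x)) :=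
    ((hb.tendsto x).mono_left inf_le_left).congr' (hub.filter_mono inf_le_right).symm
  -- For each y the product (β(u(y)) - β(r))(ζ(u(y)) - ζ(r)) is nonnegative by monotonicity; no
  -- value of `u` at `x` is needed.
  refine ge_of_tendsto ((h2.sub_const (β r)).mul (h1.sub_const (ζ r)))
    (Eventually.of_forall fun y => ?_)
  rcases le_total (u y) r with h | h
  · exact mul_nonneg_of_nonpos_of_nonpos (sub_nonpos.2 (hβ h)) (sub_nonpos.2 (hζ h))
  · exact mul_nonneg (sub_nonneg.2 (hβ h)) (sub_nonneg.2 (hζ h))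

/-! ### Nodal sums and global consistency -/

namespace NodalDisc

variable {d : ℕ} {Ω : Set (E d)} {M I : Type} [Fintype M] [Fintype I] {bd : Set I}
  {k : ℕ} {ρ Cg : ℝ} (S : NodalDisc Ω M I bd k ρ Cg)

/-- The weight `|U_i ∩ K|` of the quadrature rule on `K` at the node `i`. -/
noncomputable def weight (K : M) (i : I) : ℝ := (volume (S.U i ∩ S.mesh.cell K)).toReal

theorem weight_nonneg (K : M) (i : I) : 0 ≤ S.weight K i := ENNReal.toReal_nonneg

/-- The piecewise constant function on the sets `U_i ∩ K`, `i ∈ I_K`, with values `a_i`. -/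
noncomputable def step (K : M) (a : I → ℝ) (x : E d) : ℝ :=
  ∑ i ∈ S.nodes K, a i * (S.U i ∩ S.mesh.cell K).indicator (fun _ => (1 : ℝ)) x

/-- A point of a cell lies in exactly one `U i`. The index does not depend on the values `a`, so
products and compositions of step functions can be computed node by node. -/
theorem exists_node_of_mem {K : M} {x : E d} (hx : x ∈ S.mesh.cell K) :
    ∃ i, (∀ a, S.step K a x = a i) ∧
      ∀ a : I → ℝ, ∑ j, a j * (S.U j).indicator (fun _ => (1 : ℝ)) x = a i := by
  have h1 : x ∈ ⋃ i, S.U i := by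
    rw [S.lumped.const.union]; exact S.mesh.sub K hx
  obtain ⟨i, hi⟩ := mem_iUnion.1 h1
  have hiK : i ∈ S.nodes K := S.U_cell i K ⟨x, hi, hx⟩
  have huniq : ∀ j, j ≠ i → x ∉ S.U j := fun j hj hxj =>
    disjoint_left.1 (S.lumped.const.disj j i hj) hxj hi
  refine ⟨i, fun a => ?_, fun a => ?_⟩
  · rw [step, Finset.sum_eq_single_of_mem i hiK fun j _ hj => by
      rw [indicator_of_notMem fun h => huniq j hj h.1, mul_zero]]
    rw [indicator_of_mem (mem_inter hi hx), mul_one]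
  · rw [Finset.sum_eq_single_of_mem i (Finset.mem_univ i) fun j _ hj => by
      rw [indicator_of_notMem (huniq j hj), mul_zero]]
    rw [indicator_of_mem hi, mul_one]

theorem recon_ae_eq (K : M) (v : X0 bd) :
    S.D.recon v =ᵐ[volume.restrict (S.mesh.cell K)] S.step K v.1 := by
  filter_upwards [ae_restrict_of_ae_restrict_of_subset (S.mesh.sub K) (S.lumped.const.recon_eq v),
    ae_restrict_mem (S.mesh.poly K).isOpen.measurableSet] with x hx hxK
  obtain ⟨i, h1, h2⟩ := S.exists_node_of_mem hxK
  rw [hx, h1, h2]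

theorem measurableSet_U_inter_cell (K : M) (i : I) : MeasurableSet (S.U i ∩ S.mesh.cell K) :=
  (S.lumped.const.meas i).inter (S.mesh.poly K).isOpen.measurableSet

theorem integrableOn_indicator (K : M) (i : I) :
    IntegrableOn ((S.U i ∩ S.mesh.cell K).indicator (fun _ => (1 : ℝ))) (S.mesh.cell K) :=
  ((integrable_indicator_iff (S.measurableSet_U_inter_cell K i)).2 (integrableOn_const
    ((measure_mono inter_subset_right).trans_lt
      (S.mesh.poly K).isBounded.measure_lt_top).ne)).restrict

theorem integrableOn_step (K : M) (a : I → ℝ) : IntegrableOn (S.step K a) (S.mesh.cell K) :=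
  integrable_finsetSum _ fun i _ => (S.integrableOn_indicator K i).const_mul _

theorem integral_step (K : M) (a : I → ℝ) :
    ∫ x in S.mesh.cell K, S.step K a x = ∑ i ∈ S.nodes K, S.weight K i * a i := by
  have hm := S.measurableSet_U_inter_cell K
  simp only [step]
  rw [integral_finsetSum _ fun i _ => (S.integrableOn_indicator K i).const_mul _]
  refine Finset.sum_congr rfl fun i _ => ?_
  rw [integral_const_mul, integral_indicator (hm i), Measure.restrict_restrict (hm i),
    inter_eq_left.2 inter_subset_right, setIntegral_const, smul_eq_mul, mul_one, mul_comm]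
  rfl

/-- Integrals against a reconstructed function of a function that is constant on each `U_i ∩ K`. -/
theorem integral_mul_recon {b : E d → ℝ} {B : M → I → ℝ}
    (hb : ∀ K, b =ᵐ[volume.restrict (S.mesh.cell K)] S.step K (B K)) (v : X0 bd) :
    ∫ x in Ω, b x * S.D.recon v x
      = ∑ K, ∑ i ∈ S.nodes K, S.weight K i * (B K i * v.1 i) := by
  have hae : ∀ K, (fun x => b x * S.D.recon v x) =ᵐ[volume.restrict (S.mesh.cell K)]
      S.step K (fun i => B K i * v.1 i) := fun K => by
    filter_upwards [hb K, S.recon_ae_eq K v,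
      ae_restrict_mem (S.mesh.poly K).isOpen.measurableSet] with x h1 h2 hxK
    obtain ⟨i, h3, -⟩ := S.exists_node_of_mem hxK
    rw [h1, h2, h3, h3, h3]
  rw [S.mesh.integral_eq_sum fun K => (S.integrableOn_step K _).congr (hae K).symm]
  exact Finset.sum_congr rfl fun K _ => by rw [integral_congr_ae (hae K), S.integral_step]

theorem comp_recon_ae_eq (K : M) (v : X0 bd) (β : ℝ → ℝ) :
    (fun x => β (S.D.recon v x)) =ᵐ[volume.restrict (S.mesh.cell K)]
      S.step K (fun i => β (v.1 i)) := by
  filter_upwards [S.recon_ae_eq K v,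
    ae_restrict_mem (S.mesh.poly K).isOpen.measurableSet] with x h2 hxK
  obtain ⟨i, h3, -⟩ := S.exists_node_of_mem hxK
  rw [h2, h3, h3]

/-- A centre of star-shapedness of a nonempty set belongs to it, so the cell lies within its
diameter of `c`. -/
theorem exists_isStarBall (hd : 1 ≤ d) (hρ : 0 < ρ) (K : M) :
    ∃ c : E d, IsStarBall (S.mesh.cell K) c (ρ * Metric.diam (S.mesh.cell K))
      (Metric.diam (S.mesh.cell K)) := by
  obtain ⟨c, hc⟩ := S.star K
  have hpos : 0 < ρ * Metric.diam (S.mesh.cell K) := mul_pos hρ (S.mesh.diam_pos hd K)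
  have hne := (S.mesh.conn K).nonempty
  refine ⟨c, (S.mesh.poly K).isOpen, hne, hpos, hc, fun x hx => ?_⟩
  exact Metric.dist_le_diam_of_mem (S.mesh.poly K).isBounded hx
    ((hc c (Metric.mem_ball_self hpos)).mem hne)

theorem memLp_top_cell {g : E d → ℝ} {s : ℕ} (hg : S.mesh.MemBroken s g) (K : M) (p : ℝ≥0∞) :
    MemLp g p (volume.restrict (S.mesh.cell K)) := by
  have : IsFiniteMeasure (volume.restrict (S.mesh.cell K)) :=
    ⟨by rw [Measure.restrict_apply_univ]; exact (S.mesh.poly K).isBounded.measure_lt_top⟩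
  exact (hg.1.mono_measure (Measure.restrict_mono (S.mesh.sub K) le_rfl)).mono_exponent le_top

/-- On each cell, a function in `W^{s,∞}(M)`, `s ≥ 1`, has a Lipschitz continuous
representative. -/
theorem exists_lipschitz_rep (hd : 1 ≤ d) (hρ : 0 < ρ) {s : ℕ} (hs : 1 ≤ s) {g : E d → ℝ}
    (hg : S.mesh.MemBroken s g) (K : M) :
    ∃ (L : NNReal) (gc : E d → ℝ), LipschitzWith L gc ∧
      g =ᵐ[volume.restrict (S.mesh.cell K)] gc := by
  obtain ⟨c, hc⟩ := S.exists_isStarBall hd hρ K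
  exact GDM.exists_lipschitz_rep hc (memLp_one_iff_integrable.1 (S.memLp_top_cell hg K 1))
    ((hg.2 K).weakBound.mono hs le_rfl)

/-- Cauchy-Schwarz over the cells: the volumes add up to |Ω| and the squared local norms to the
squared global norm, whatever the number of cells. -/
theorem sum_sqrt_volume_mul_recon (v : X0 bd) :
    ∑ K, Real.sqrt (volume.real (S.mesh.cell K)) *
      Real.sqrt (∫ x in S.mesh.cell K, peval (S.loc v K) x ^ 2)
      ≤ Real.sqrt (volume.real Ω) * ‖S.Ds.recon v‖ := by
  have hrec : ∑ K, ∫ x in S.mesh.cell K, peval (S.loc v K) x ^ 2 = ‖S.Ds.recon v‖ ^ 2 := by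
    rw [norm_sq_eq_integral, S.mesh.integral_eq_sum fun K =>
      ((Lp.memLp (S.Ds.recon v)).integrable_norm_pow two_ne_zero).mono_measure
        (Measure.restrict_mono (S.mesh.sub K) le_rfl)]
    refine Finset.sum_congr rfl fun K _ => integral_congr_ae ?_
    filter_upwards [S.loc_eq v K] with x hx
    rw [hx, Real.norm_eq_abs, sq_abs]
  refine (Real.sum_sqrt_mul_sqrt_le _ (fun _ => measureReal_nonneg)
    fun K => integral_nonneg fun x => sq_nonneg _).trans (le_of_eq ?_)
  rw [S.mesh.sum_volume_cell, hrec, Real.sqrt_sq (norm_nonneg _)]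

theorem sum_sqrt_volume_mul_grad (v : X0 bd) :
    ∑ K, Real.sqrt (volume.real (S.mesh.cell K)) *
      Real.sqrt (∫ x in S.mesh.cell K, ∑ a, peval (MvPolynomial.pderiv a (S.loc v K)) x ^ 2)
      ≤ Real.sqrt (volume.real Ω) * (Cg * ‖S.Ds.grad v‖) := by
  refine (Real.sum_sqrt_mul_sqrt_le _ (fun _ => measureReal_nonneg)
    fun K => integral_nonneg fun x => Finset.sum_nonneg fun a _ => sq_nonneg _).trans ?_
  rw [S.mesh.sum_volume_cell]
  exact mul_le_mul_of_nonneg_left (S.grad_bound v) (Real.sqrt_nonneg _)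

end NodalDisc

/-- The quadrature and mass-lumping error, tested with a reconstructed function. -/
theorem NodalDisc.exists_consistency_bound (d k : ℕ) (hd : 1 ≤ d) (hk : 1 ≤ k) {ρ : ℝ} (hρ : 0 < ρ)
    (Cg : ℝ) (hCg : 0 ≤ Cg) (Ω : Set (E d)) (l s : ℕ) (hs1 : 1 ≤ s) (hs2 : s ≤ l + 2) :
    ∃ C : ℝ, 0 ≤ C ∧ ∀ (M I : Type) [Fintype M] [Fintype I] (bd : Set I)
      (S : NodalDisc Ω M I bd k ρ Cg), S.Exact (k + l) →
      ∀ (g : E d → ℝ) (gc : M → E d → ℝ) (L : M → NNReal), (∀ K, MemW (S.mesh.cell K) s g) →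
      (∀ K, LipschitzWith (L K) (gc K)) → (∀ K, g =ᵐ[volume.restrict (S.mesh.cell K)] gc K) →
      ∀ v : X0 bd,
        |∑ K, ((∑ i ∈ S.nodes K, S.weight K i * (gc K (S.node i) * v.1 i))
          - ∫ x in S.mesh.cell K, gc K x * peval (S.loc v K) x)|
          ≤ C * (S.mesh.size ^ s * (1 + S.Ds.poincare) * S.mesh.brokenNorm s g)
            * ‖S.Ds.grad v‖ := by
  obtain ⟨C, hC, hquad⟩ := exists_quadrature_bound d k hk hρ l s hs1 hs2
  refine ⟨C * Real.sqrt (volume.real Ω) * (1 + Cg), by positivity,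
    fun M I _ _ bd S hex g gc L hW hL hgc v => ?_⟩
  set h := S.mesh.size
  set N := S.mesh.brokenNorm s g
  have hN : 0 ≤ N := S.mesh.brokenNorm_nonneg s g
  have hh : 0 ≤ h := S.mesh.size_nonneg
  set R := fun K => Real.sqrt (volume.real (S.mesh.cell K))
  set A := fun K => Real.sqrt (∫ x in S.mesh.cell K, peval (S.loc v K) x ^ 2)
  set B := fun K => Real.sqrt (∫ x in S.mesh.cell K,
    ∑ a, peval (MvPolynomial.pderiv a (S.loc v K)) x ^ 2)
  have hcell : ∀ K, |(∑ i ∈ S.nodes K, S.weight K i * (gc K (S.node i) * v.1 i))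
      - ∫ x in S.mesh.cell K, gc K x * peval (S.loc v K) x|
      ≤ C * h ^ s * N * (R K * (A K + B K)) := by
    intro K
    obtain ⟨c, hc⟩ := S.exists_isStarBall hd hρ K
    have h1 := hquad _ c _ (S.mesh.diam_pos hd K) hc I (S.nodes K) (S.weight K) S.node
      (fun i _ => S.weight_nonneg K i) (S.node_cell K) (hex K) g (gc K) (L K) (hL K) (hgc K) N hN
      ((hW K).weakBound.mono le_rfl (S.mesh.wNorm_le_brokenNorm K s g)) (S.loc v K) (S.loc_deg v K)
    have h2 : ∑ i ∈ S.nodes K, S.weight K i * (gc K (S.node i) * v.1 i)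
        = ∑ i ∈ S.nodes K, S.weight K i * (gc K (S.node i) * peval (S.loc v K) (S.node i)) :=
      Finset.sum_congr rfl fun i hi => by rw [S.nodal v K i hi]
    rw [h2]
    refine h1.trans ?_
    have h3 : Metric.diam (S.mesh.cell K) ^ s ≤ h ^ s :=
      pow_le_pow_left₀ Metric.diam_nonneg (S.mesh.diam_le_size K) s
    gcongr
  refine (Finset.abs_sum_le_sum_abs _ _).trans ((Finset.sum_le_sum fun K _ => hcell K).trans ?_)
  rw [← Finset.mul_sum]
  -- The values contribute C_{D*} and the broken gradients `Cg`; their sum is at most (1 + Cg)(1 +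
  -- C_{D*}).
  have e1 : ∑ K, R K * (A K + B K) ≤ Real.sqrt (volume.real Ω)
      * ((1 + Cg) * (1 + S.Ds.poincare) * ‖S.Ds.grad v‖) := by
    simp only [mul_add, Finset.sum_add_distrib]
    refine (add_le_add (S.sum_sqrt_volume_mul_recon v) (S.sum_sqrt_volume_mul_grad v)).trans ?_
    rw [← mul_add]
    refine mul_le_mul_of_nonneg_left ?_ (Real.sqrt_nonneg _)
    have h1 := S.Ds.norm_recon_le v
    have h2 := S.Ds.poincare_nonneg
    have h3 : 0 ≤ ‖S.Ds.grad v‖ := norm_nonneg _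
    have h4 : 0 ≤ Cg * S.Ds.poincare * ‖S.Ds.grad v‖ := by positivity
    linarith
  refine (mul_le_mul_of_nonneg_left e1 (by positivity)).trans (le_of_eq ?_)
  ring

/-- The arithmetic of the energy estimate. Here x = ‖∇e‖ and y = ‖∇w - G‖; `aw`, `au`, `aG`, `ad`
are the diffusion form of ∇w, ∇ζ(u), G, ∇w - G against ∇e; `sβ`, `sf` are the nodal sums of the
scheme, `sg` = ∫ g Π*e, and `sm` is the monotone sum. The identity behind it is aw - au = ad + (aG +
sg) + (sm + sβ - sf - sg) - sm, after which one factor x is cancelled. -/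
theorem le_of_energy_bounds {lo hi C x y W Q aw au aG ad sβ sf sg sm : ℝ} (hlo : 0 < lo)
    (hhi : 0 ≤ hi) (hC : 0 ≤ C) (hx : 0 ≤ x) (hy : 0 ≤ y) (hW : 0 ≤ W) (hQ : 0 ≤ Q)
    (hcoer : lo * x ^ 2 ≤ aw - au) (hG : ad = aw - aG) (hGb : |ad| ≤ hi * y * x)
    (hscheme : sβ + au = sf) (hdef : |aG + sg| ≤ W * x) (hT : |sm + sβ - sf - sg| ≤ C * Q * x)
    (hmono : 0 ≤ sm) : x ≤ (1 + hi + C) / lo * (W + y + Q) := by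
  have hmain : lo * x ^ 2 ≤ (hi * y + W + C * Q) * x := by
    linarith [(abs_le.1 hGb).2, (abs_le.1 hdef).2, (abs_le.1 hT).2]
  have hfinal : lo * x ≤ hi * y + W + C * Q := by
    rcases hx.eq_or_lt with h0 | h0
    · rw [← h0, mul_zero]; positivity
    · refine le_of_mul_le_mul_right ?_ h0
      linarith [sq x]
  rw [div_mul_eq_mul_div, le_div_iff₀ hlo]
  have h1 : 0 ≤ hi * W + C * W + y + C * y + Q + hi * Q := by positivity
  linarith

end GDM

/-! ### The error estimate -/

theorem mainTheorem1
    (d : ℕ) (hd1 : 1 ≤ d) (hd3 : d ≤ 3)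
    (Ω : Set (E d)) (hΩ : IsPolytopal Ω) (hΩc : IsConnected Ω)
    (lo hi : ℝ) (hlo : 0 < lo) (hlohi : lo ≤ hi)
    (ρ : ℝ) (hρ : 0 < ρ) (Cg : ℝ) (hCg : 0 ≤ Cg)
    (k : ℕ) (hk : 1 ≤ k) (l s : ℕ) (hs1 : 1 ≤ s) (hs2 : s ≤ l + 2) :
    ∃ C : ℝ, 0 < C ∧
      ∀ (ζ β : ℝ → ℝ) (hnl : IsNonlin ζ β)
        (Λ : E d → Matrix (Fin d) (Fin d) ℝ) (_ : IsDiffusion Ω lo hi Λ)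
        (f ubar : L2 Ω) (G : L2v Ω) (_ : IsWeakSol Ω ζ β Λ f 0 ubar G)
        (M I : Type) [Fintype M] [Fintype I] (bd : Set I)
        (S : NodalDisc Ω M I bd k ρ Cg) (_ : S.Exact (k + l))
        (_ : S.mesh.MemBroken s f) (_ : S.mesh.MemBroken s (fun x => β (ubar x)))
        (w : X0 bd) (_ : ∀ i, HasNodalValue Ω (fun x => ζ (ubar x)) (S.node i) (w.1 i))
        (u : X0 bd) (_ : IsSchemeSol S.D ζ β hnl.ζ_zero Λ f 0 u),
        ‖S.D.grad (w - X0.map ζ hnl.ζ_zero u)‖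
          ≤ C * (S.Ds.defect (matField Λ G) + ‖S.D.grad w - G‖
              + S.mesh.size ^ s * (1 + S.Ds.poincare)
                * S.mesh.brokenNorm s (fun x => β (ubar x) - f x)) := by
  obtain ⟨C, hC, hcons⟩ :=
    NodalDisc.exists_consistency_bound d k hd1 hk hρ Cg hCg Ω l s hs1 hs2
  have hlo0 := hlo.le
  have hhi0 := hlo0.trans hlohi
  refine ⟨(1 + hi + C) / lo, by positivity, ?_⟩
  intro ζ β hnl Λ hΛ f ubar G hsol M I _ _ bd S hex hf hβ w hw u hu
  set e := w - X0.map ζ hnl.ζ_zero u with he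
  have hgrad : S.D.grad = S.Ds.grad := S.lumped.grad_eq
  set g : E d → ℝ := fun x => β (ubar x) - f x with hg
  have hfin : IsFiniteMeasure (volume.restrict Ω) :=
    ⟨by rw [Measure.restrict_apply_univ]; exact hΩ.isBounded.measure_lt_top⟩
  -- `f` and β(ū) get separate representatives: the scheme uses nodal values of `f`, the
  -- monotonicity argument those of β(ū). Their difference represents `g`.
  choose Lf fc hLf hfc using S.exists_lipschitz_rep hd1 hρ hs1 hf
  choose Lb bc hLb hbc using S.exists_lipschitz_rep hd1 hρ hs1 hβ
  set gc : M → E d → ℝ := fun K x => bc K x - fc K x with hgcdef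
  have hgc : ∀ K, g =ᵐ[volume.restrict (S.mesh.cell K)] gc K := fun K => by
    filter_upwards [hbc K, hfc K] with x h1 h2
    exact congrArg₂ (· - ·) h1 h2
  have hψ := hΛ.memLp_matField hlo0 hhi0 G
  -- consistency of the right-hand side
  have hT := hcons M I bd S hex g gc (fun K => Lb K + Lf K)
    (fun K => MemW.sub (S.mesh.poly K).isBounded.measure_lt_top (S.memLp_top_cell hβ K 2)
      (S.memLp_top_cell hf K 2) (hβ.2 K) (hf.2 K))
    (fun K => (hLb K).sub (hLf K)) hgc e
  -- the scheme
  have hscheme := hu e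
  have hF : ∫ x in Ω, inner ℝ ((0 : L2v Ω) x) (S.D.grad e x) = 0 := by
    rw [← integral_zero (E d) ℝ (μ := volume.restrict Ω)]
    refine integral_congr_ae ((Lp.coeFn_zero (E d) 2 (volume.restrict Ω)).mono fun x hx => ?_)
    simp only [hx, Pi.zero_apply, inner_zero_left]
  rw [hF, sub_zero, S.integral_mul_recon (fun K => S.comp_recon_ae_eq K u β),
    S.integral_mul_recon (B := fun K i => fc K (S.node i))
      (fun K => S.quad_eq f fc (fun K => (hLf K).continuous.continuousOn) hfc K)] at hscheme
  -- the defect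
  have hdef := S.Ds.abs_integral_le_defect hψ e
  rw [S.Ds.integral_defect_eq hψ] at hdef
  -- On each cell the divergence of the flux is `gc K` and Π*e is the polynomial `loc e K`, so this
  -- is the integral that the quadrature error involves.
  have hdiv : ∫ x in Ω, S.Ds.recon e x * weakDiv Ω (matField Λ G) x
      = ∑ K, ∫ x in S.mesh.cell K, gc K x * peval (S.loc e K) x := by
    have hwd := hsol.weakDiv_ae_eq hΩ.isOpen (hβ.1.mono_exponent le_top)
    rw [S.mesh.integral_eq_sum (f := fun x => S.Ds.recon e x * weakDiv Ω (matField Λ G) x) fun K =>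
      ((Lp.memLp (S.Ds.recon e)).integrable_mul
        (Lp.memLp (weakDiv Ω (matField Λ G)))).mono_measure
          (Measure.restrict_mono (S.mesh.sub K) le_rfl)]
    refine Finset.sum_congr rfl fun K _ => integral_congr_ae ?_
    filter_upwards [ae_restrict_of_ae_restrict_of_subset (S.mesh.sub K) hwd, hgc K, S.loc_eq e K]
      with x h1 h2 h3
    rw [h1, h3, mul_comm, ← h2]
  have hsymm : ∫ x in Ω, inner ℝ (S.Ds.grad e x) (matField Λ G x)
      = ∫ x in Ω, inner ℝ (matField Λ G x) (S.Ds.grad e x) := by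
    simp only [real_inner_comm]
  rw [hdiv, hsymm] at hdef
  -- monotonicity
  have hmono : 0 ≤ ∑ K, ∑ i ∈ S.nodes K,
      S.weight K i * ((bc K (S.node i) - β (u.1 i)) * e.1 i) :=
    Finset.sum_nonneg fun K _ => Finset.sum_nonneg fun i hi =>
      mul_nonneg (S.weight_nonneg K i) (mul_nodalValue_sub_nonneg (S.mesh.poly K).isOpen
        (S.mesh.sub K) hnl.ζ_mono hnl.β_mono (hw i) (S.node_cell K i hi) (hLb K).continuous
        (hbc K) (u.1 i))
  -- At each node g = (β(ū) - β(u_i)) + β(u_i) - f, which isolates the monotone sum and the two sums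
  -- of the scheme.
  have hsplit : ∑ K, ((∑ i ∈ S.nodes K, S.weight K i * (gc K (S.node i) * e.1 i))
        - ∫ x in S.mesh.cell K, gc K x * peval (S.loc e K) x)
      = (∑ K, ∑ i ∈ S.nodes K, S.weight K i * ((bc K (S.node i) - β (u.1 i)) * e.1 i))
        + (∑ K, ∑ i ∈ S.nodes K, S.weight K i * (β (u.1 i) * e.1 i))
        - (∑ K, ∑ i ∈ S.nodes K, S.weight K i * (fc K (S.node i) * e.1 i))
        - ∑ K, ∫ x in S.mesh.cell K, gc K x * peval (S.loc e K) x := by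
    simp only [← Finset.sum_add_distrib, ← Finset.sum_sub_distrib]
    refine Finset.sum_congr rfl fun K _ => congrArg₂ (· - ·) (Finset.sum_congr rfl fun i _ => ?_) rfl
    rw [hgcdef]
    ring
  rw [hsplit] at hT
  -- coercivity
  have hcoer := hΛ.le_integral_matField_self hlo0 hhi0 (S.D.grad e)
  have hlin : ∫ x in Ω, inner ℝ (matField Λ (S.D.grad e) x) (S.D.grad e x)
      = (∫ x in Ω, inner ℝ (matField Λ (S.D.grad w) x) (S.D.grad e x))
        - ∫ x in Ω, inner ℝ (matField Λ (S.D.grad (X0.map ζ hnl.ζ_zero u)) x) (S.D.grad e x) := by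
    rw [← hΛ.integral_matField_sub hlo0 hhi0, ← map_sub]
  have hG := hΛ.integral_matField_sub hlo0 hhi0 (S.D.grad w) G (S.D.grad e)
  have hGb := hΛ.abs_integral_matField_le hlo0 hhi0 (S.D.grad w - G) (S.D.grad e)
  rw [← hgrad] at hdef hT
  rw [hlin] at hcoer
  exact le_of_energy_bounds hlo hhi0 hC (norm_nonneg _) (norm_nonneg _)
    (S.Ds.defect_nonneg (matField Λ G))
    (mul_nonneg (mul_nonneg (pow_nonneg S.mesh.size_nonneg s)
      (add_nonneg zero_le_one S.Ds.poincare_nonneg)) (S.mesh.brokenNorm_nonneg s g))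
    hcoer hG hGb hscheme hdef hT hmono
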